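/- Call a digraph (finite, without loops, parallel arcs allowed) \emph{Eulerian} if some closed directed walk uses every arc exactly once, and consider Eulerian digraphs $G=(V,E)$ in which every node has in-degree $2$ and out-degree $2$. For a rational polyhedron $P=\{x\in\mathbb R^n: Ax=b,\ Bx\le d\}$, a \emph{circuit} is a vector $g\in\ker(A)\setminus\{0\}$ with coprime integral components such that $Bg$ is support-minimal in $\{Bx: x\in\ker(A)\setminus\{0\}\}$. A \emph{circuit walk} from $x\in P$ to $y\in P$ is a list $((g_1,\lambda_1),\dots,(g_r,\lambda_r))$ of circuits $g_i$ and step lengths $\lambda_i>0$ such that $x+\sum_{i=1}^r\lambda_ig_i=y$ and, for every $1\le j\le r$, $x+\sum_{i=1}^{j}\lambda_ig_i\in P$ and $x+\sum_{i=1}^{j-1}\lambda_ig_i+\lambda g_j\notin P$ for all $\lambda>\lambda_j$. The problem \textsc{Circ-Dist} is: given $A,b,B,d$ rational, vertices $x,y$ of $P$ and $k\in\mathbb N$ (numbers in binary), decide whether there is a circuit walk from $x$ to $y$ with at most $k$ steps. \textbf{Claim.} \textsc{Circ-Dist} is at least as hard, under polynomial-time many-one reductions, as deciding whether an Eulerian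 digraph with in-degree and out-degree $2$ at every node decomposes into two Hamiltonian dicycles (that is, whether $E$ can be partitioned into the arc sets of two simple directed cycles that each visit every node). More precisely, let $A_G$ be the oriented node-arc incidence matrix of $G$, and map $G$ to the \textsc{Circ-Dist} instance that consists of the $0/1$-circulation polytope $\{x\in\mathbb R^{E}: A_Gx=0,\ 0\le x\le 1\}$, its vertices $x=(0,\dots,0)$ (zero flow) and $y=(1,\dots,1)$ (full flow), and $k=2$. This map is computable in time polynomial in the encoding length of $G$, and $G$ decomposes into two Hamiltonian dicycles if and only if the answer to this instance of \textsc{Circ-Dist} is yes. -/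

import Mathlib

open scoped Matrix

noncomputable section

namespace CircuitDistance

/-! ### Decision problems and polynomial-time reductions -/

/-- A decision problem: a type of instances, their encoding as words over a finite alphabet, and
the set of yes-instances. -/
structure DecisionProblem where
  /-- the (valid) instances -/
  Instance : Type
  /-- the alphabet -/
  Letter : Type
  /-- the alphabet is finite -/
  [letterFintype : Fintype Letter]
  /-- the encoding of instances as words -/
  encoding : Computability.Encoding Instance Letter
  /-- the yes-instances -/
  Yes : Instance → Prop

/-- `f` is a polynomial-time many-one (Karp) reduction from `L` to `M`: a multi-stack Turing
machine computes the encoding of `f a` from the encoding of `a`, in a number of steps that is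
polynomial in the length of the encoding of `a`, and `f` preserves the answer. -/
def IsPolyTimeReduction (L M : DecisionProblem) (f : L.Instance → M.Instance) : Prop :=
  Nonempty (Turing.TM2ComputableInPolyTime L.encoding.encode M.encoding.encode f) ∧
    ∀ a, L.Yes a ↔ M.Yes (f a)

/-- `L` is polynomial-time many-one reducible to `M`: the problem `M` is at least as hard as
`L`. -/
def PolyTimeReducible (L M : DecisionProblem) : Prop :=
  ∃ f : L.Instance → M.Instance, IsPolyTimeReduction L M f

/-- The encoding given by an injective map to words. -/
def encodingOfInjective {α Γ : Type} (enc : α → List Γ) (h : Function.Injective enc) :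
    Computability.Encoding α Γ where
  encode := enc
  decode := Function.partialInv enc
  decode_encode := Function.partialInv_left h

/-! ### Polyhedra, circuits and circuit walks -/

/-- A rational description `A x = b`, `B x ≤ d` of a polyhedron in `ℝⁿ`. -/
structure RatPolyhedron (n : ℕ) where
  /-- number of equations -/
  numEq : ℕ
  /-- number of inequalities -/
  numIneq : ℕ
  /-- matrix of the equations -/
  A : Matrix (Fin numEq) (Fin n) ℚ
  /-- right-hand side of the equations -/
  b : Fin numEq → ℚ
  /-- matrix of the inequalities -/
  B : Matrix (Fin numIneq) (Fin n) ℚ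
  /-- right-hand side of the inequalities -/
  d : Fin numIneq → ℚ

/-- A rational vector as a real vector. -/
def castVec {ι : Type} (v : ι → ℚ) : ι → ℝ := fun i => (v i : ℝ)

namespace RatPolyhedron

variable {n : ℕ} (P : RatPolyhedron n)

/-- The matrix `A` over the reals. -/
def realA : Matrix (Fin P.numEq) (Fin n) ℝ := P.A.map (fun q : ℚ => (q : ℝ))

/-- The matrix `B` over the reals. -/
def realB : Matrix (Fin P.numIneq) (Fin n) ℝ := P.B.map (fun q : ℚ => (q : ℝ))

/-- The polyhedron `{x : A x = b, B x ≤ d}`. -/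
def toSet : Set (Fin n → ℝ) :=
  {x | P.realA *ᵥ x = castVec P.b ∧ P.realB *ᵥ x ≤ castVec P.d}

/-- `x` is a vertex (extreme point) of the polyhedron. -/
def IsVertex (x : Fin n → ℝ) : Prop := x ∈ Set.extremePoints ℝ P.toSet

/-- The circuits of the description: the `g ∈ ker A \ {0}` with coprime integral components for
which `B g` is support-minimal in `{B x : x ∈ ker A \ {0}}`. -/
def IsCircuit (g : Fin n → ℝ) : Prop :=
  P.realA *ᵥ g = 0 ∧ g ≠ 0 ∧
    (∀ h : Fin n → ℝ, P.realA *ᵥ h = 0 → h ≠ 0 →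
      ¬ Function.support (P.realB *ᵥ h) ⊂ Function.support (P.realB *ᵥ g)) ∧
    ∃ z : Fin n → ℤ, (∀ i, g i = (z i : ℝ)) ∧ Finset.univ.gcd z = 1

end RatPolyhedron

/-- The point `x + ∑_{i ≤ j} λᵢ gᵢ` reached from `x` after the first `j` steps of the list `W` of
pairs `(gᵢ, λᵢ)`. -/
def walkPoint {n : ℕ} (x : Fin n → ℝ) (W : List ((Fin n → ℝ) × ℝ)) (j : ℕ) : Fin n → ℝ :=
  x + ((W.take j).map (fun s => s.2 • s.1)).sum

/-- `W = ((g₁, λ₁), …, (g_r, λ_r))` is a (maximal) circuit walk from `x` to `y`. -/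
structure IsCircuitWalk {n : ℕ} (P : RatPolyhedron n) (x y : Fin n → ℝ)
    (W : List ((Fin n → ℝ) × ℝ)) : Prop where
  circuit : ∀ s ∈ W, P.IsCircuit s.1
  pos : ∀ s ∈ W, 0 < s.2
  reach : walkPoint x W W.length = y
  feasible : ∀ j, 1 ≤ j → j ≤ W.length → walkPoint x W j ∈ P.toSet
  maximal : ∀ (j : ℕ) (hj : j < W.length) (t : ℝ), W[j].2 < t →
    walkPoint x W j + t • W[j].1 ∉ P.toSet

/-! ### The problem Circ-Dist -/

/-- An instance of the circuit distance problem: a rational polyhedron, two of its vertices, and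
a number `k`. -/
structure CircDistInstance where
  /-- the dimension -/
  n : ℕ
  /-- the polyhedron -/
  P : RatPolyhedron n
  /-- the start vertex -/
  x : Fin n → ℚ
  /-- the target vertex -/
  y : Fin n → ℚ
  /-- the bound on the number of steps -/
  k : ℕ
  isVertex_x : P.IsVertex (castVec x)
  isVertex_y : P.IsVertex (castVec y)

/-- There is a circuit walk from `x` to `y` with at most `k` steps. -/
def CircDistInstance.Yes (I : CircDistInstance) : Prop :=
  ∃ W : List ((Fin I.n → ℝ) × ℝ),
    IsCircuitWalk I.P (castVec I.x) (castVec I.y) W ∧ W.length ≤ I.k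

/-- The alphabet for instances of the circuit distance problem. -/
inductive LPLetter
  | bit (b : Bool)
  | minus
  | slash
  | comma
  | semicolon
  | bar
  deriving DecidableEq, Fintype

/-- Binary notation of a natural number. -/
def encNat (k : ℕ) : List LPLetter := (Computability.encodeNat k).map LPLetter.bit

/-- A rational number in lowest terms, with numerator and denominator in binary. -/
def encRat (q : ℚ) : List LPLetter :=
  (if q < 0 then [LPLetter.minus] else []) ++ encNat q.num.natAbs ++
    LPLetter.slash :: encNat q.den

/-- A list of rational numbers: every entry ends with a comma, the list ends with a semicolon. -/
def encRatList (l : List ℚ) : List LPLetter :=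
  l.flatMap (fun q => encRat q ++ [LPLetter.comma]) ++ [LPLetter.semicolon]

/-- A list of rows, ended by a bar. -/
def encRows (l : List (List ℚ)) : List LPLetter :=
  l.flatMap encRatList ++ [LPLetter.bar]

/-- A vector, entry by entry. -/
def encVec {n : ℕ} (v : Fin n → ℚ) : List LPLetter := encRatList (List.ofFn v)

/-- A matrix, row by row. -/
def encMat {m n : ℕ} (M : Matrix (Fin m) (Fin n) ℚ) : List LPLetter :=
  encRows (List.ofFn fun i => List.ofFn (M i))

/-- The word that encodes an instance: `A`, `b`, `B`, `d`, `x`, `y` and `k` in binary. -/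
def encCircDist (I : CircDistInstance) : List LPLetter :=
  encMat I.P.A ++ (encVec I.P.b ++ (encMat I.P.B ++ (encVec I.P.d ++
    (encVec I.x ++ (encVec I.y ++ encNat I.k)))))

/-- A code all of whose words show where they end. -/
def SelfDelimiting {α Γ : Type} (enc : α → List Γ) : Prop :=
  ∀ a b r s, enc a ++ r = enc b ++ s → a = b ∧ r = s

theorem append_cons_cancel {Γ : Type} {t : Γ} : ∀ {u v r s : List Γ}, t ∉ u → t ∉ v →
    u ++ t :: r = v ++ t :: s → u = v ∧ r = s
  | [], [], _, _, _, _, h => by simpa using h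
  | [], c :: v, _, _, _, hv, h => by
      simp only [List.nil_append, List.cons_append, List.cons.injEq] at h
      exact absurd (h.1 ▸ List.mem_cons_self) hv
  | c :: u, [], _, _, hu, _, h => by
      simp only [List.nil_append, List.cons_append, List.cons.injEq] at h
      exact absurd (h.1 ▸ List.mem_cons_self) hu
  | c :: u, e :: v, r, s, hu, hv, h => by
      simp only [List.cons_append, List.cons.injEq] at h
      have := append_cons_cancel (fun k => hu (List.mem_cons_of_mem _ k))
        (fun k => hv (List.mem_cons_of_mem _ k)) h.2
      exact ⟨by rw [h.1, this.1], this.2⟩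

theorem SelfDelimiting.of_injective {α Γ : Type} {w : α → List Γ} {t : Γ}
    (hw : Function.Injective w) (ht : ∀ a, t ∉ w a) :
    SelfDelimiting (fun a => w a ++ [t]) := by
  intro a b r s h
  simp only [List.append_assoc, List.singleton_append] at h
  have := append_cons_cancel (ht a) (ht b) h
  exact ⟨hw this.1, this.2⟩

theorem SelfDelimiting.list {α Γ : Type} {w : α → List Γ} {t : Γ} (hw : SelfDelimiting w)
    (ht : ∀ a, t ∉ w a) (hne : ∀ a, w a ≠ []) :
    SelfDelimiting (fun l : List α => l.flatMap w ++ [t]) := by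
  have key : ∀ (a : α) (u r : List Γ), t :: r ≠ w a ++ u := by
    intro a u r h
    obtain ⟨c, v, hc⟩ := List.exists_cons_of_ne_nil (hne a)
    rw [hc, List.cons_append, List.cons.injEq] at h
    exact ht a (by rw [hc, h.1]; exact List.mem_cons_self)
  intro l
  induction l with
  | nil =>
    intro l' r s h
    cases l' with
    | nil => simpa using h
    | cons a l' =>
      simp only [List.flatMap_nil, List.flatMap_cons, List.nil_append, List.append_assoc,
        List.singleton_append] at h
      exact absurd h (key _ _ _)
  | cons a l ih =>
    intro l' r s h
    cases l' with
    | nil =>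
      simp only [List.flatMap_nil, List.flatMap_cons, List.nil_append, List.append_assoc,
        List.singleton_append] at h
      exact absurd h.symm (key _ _ _)
    | cons a' l' =>
      simp only [List.flatMap_cons, List.append_assoc] at h
      obtain ⟨h1, h2⟩ := hw _ _ _ _ h
      obtain ⟨h3, h4⟩ := ih l' r s (by simpa using h2)
      exact ⟨by rw [h1, h3], h4⟩

theorem encodeNat_injective : Function.Injective Computability.encodeNat :=
  Computability.encodingNatBool.encode_injective

theorem encNat_injective : Function.Injective encNat := by
  intro a b h
  exact encodeNat_injective
    (List.map_injective_iff.2 (fun x y hxy => by simpa using hxy) h)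

theorem encRat_injective : Function.Injective encRat := by
  have main : ∀ p q : ℚ, encNat p.num.natAbs ++ LPLetter.slash :: encNat p.den =
      encNat q.num.natAbs ++ LPLetter.slash :: encNat q.den →
      p.num.natAbs = q.num.natAbs ∧ p.den = q.den := by
    intro p q h
    obtain ⟨h1, h2⟩ := append_cons_cancel (by simp [encNat]) (by simp [encNat]) h
    exact ⟨encNat_injective h1, encNat_injective h2⟩
  have hno : ∀ p q : ℚ, LPLetter.minus :: (encNat p.num.natAbs ++ LPLetter.slash ::
      encNat p.den) ≠ encNat q.num.natAbs ++ LPLetter.slash :: encNat q.den := by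
    intro p q h
    have : LPLetter.minus ∈ encNat q.num.natAbs ++ LPLetter.slash :: encNat q.den := by
      rw [← h]; exact List.mem_cons_self
    simp [encNat] at this
  intro p q h
  unfold encRat at h
  by_cases hp : p < 0 <;> by_cases hq : q < 0
  · simp only [hp, hq, if_true, List.singleton_append] at h
    obtain ⟨h1, h2⟩ := main p q (List.cons.inj h).2
    have hp' := Rat.num_neg.2 hp
    have hq' := Rat.num_neg.2 hq
    exact Rat.ext (by omega) h2
  · simp only [hp, hq, if_true, if_false, List.singleton_append,
      List.nil_append] at h
    exact absurd h (hno p q)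
  · simp only [hp, hq, if_true, if_false, List.singleton_append,
      List.nil_append] at h
    exact absurd h.symm (hno q p)
  · simp only [hp, hq, if_false, List.nil_append] at h
    obtain ⟨h1, h2⟩ := main p q h
    have hp' := Rat.num_nonneg.2 (not_lt.1 hp)
    have hq' := Rat.num_nonneg.2 (not_lt.1 hq)
    exact Rat.ext (by omega) h2

theorem encRat_mem {q : ℚ} {c : LPLetter} (h : c ∈ encRat q) :
    c ≠ LPLetter.comma ∧ c ≠ LPLetter.semicolon ∧ c ≠ LPLetter.bar := by
  unfold encRat encNat at h
  cases c <;> split_ifs at h <;> simp_all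

theorem encRatList_selfDelimiting : SelfDelimiting encRatList :=
  SelfDelimiting.list
    (SelfDelimiting.of_injective encRat_injective fun _ h => (encRat_mem h).1 rfl)
    (fun q h => by
      rcases List.mem_append.1 h with h | h
      · exact (encRat_mem h).2.1 rfl
      · simp at h)
    (fun q => by simp)

theorem encRows_selfDelimiting : SelfDelimiting encRows :=
  SelfDelimiting.list encRatList_selfDelimiting
    (fun l h => by
      unfold encRatList at h
      simp only [List.mem_append, List.mem_flatMap, List.mem_singleton, reduceCtorEq,
        or_false] at h
      obtain ⟨q, -, h⟩ := h
      exact (encRat_mem h).2.2 rfl)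
    (fun l => by simp [encRatList])

theorem encCircDist_injective : Function.Injective encCircDist := by
  rintro ⟨n, ⟨m, p, A, b, B, d⟩, x, y, k, hx, hy⟩ ⟨n', ⟨m', p', A', b', B', d'⟩, x', y', k', hx', hy'⟩ h
  simp only [encCircDist, encMat, encVec] at h
  obtain ⟨hA, h⟩ := encRows_selfDelimiting _ _ _ _ h
  obtain ⟨hb, h⟩ := encRatList_selfDelimiting _ _ _ _ h
  obtain ⟨hB, h⟩ := encRows_selfDelimiting _ _ _ _ h
  obtain ⟨hd, h⟩ := encRatList_selfDelimiting _ _ _ _ h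
  obtain ⟨hxx, h⟩ := encRatList_selfDelimiting _ _ _ _ h
  obtain ⟨hyy, h⟩ := encRatList_selfDelimiting _ _ _ _ h
  have hk := encNat_injective h
  have hn : n = n' := by simpa using congrArg List.length hxx
  have hm : m = m' := by simpa using congrArg List.length hb
  have hp : p = p' := by simpa using congrArg List.length hd
  subst hn hm hp hk
  have e1 := List.ofFn_injective hb
  have e2 := List.ofFn_injective hd
  have e3 := List.ofFn_injective hxx
  have e4 := List.ofFn_injective hyy
  have e5 : A = A' := funext fun i => List.ofFn_injective (congrFun (List.ofFn_injective hA) i)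
  have e6 : B = B' := funext fun i => List.ofFn_injective (congrFun (List.ofFn_injective hB) i)
  subst e1 e2 e3 e4 e5 e6
  rfl

/-- The problem Circ-Dist: given a rational polyhedron, two of its vertices `x`, `y` and a natural
number `k`, is there a circuit walk from `x` to `y` with at most `k` steps? -/
def circDist : DecisionProblem where
  Instance := CircDistInstance
  Letter := LPLetter
  encoding := encodingOfInjective encCircDist encCircDist_injective
  Yes := CircDistInstance.Yes

/-! ### Eulerian digraphs and Hamiltonian dicycles -/

/-- A finite digraph on the nodes `0, …, n - 1` with arcs `0, …, m - 1`. There are no loops;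
parallel arcs are allowed, so every simple digraph is covered. -/
structure FinDigraph where
  /-- number of nodes -/
  n : ℕ
  /-- number of arcs -/
  m : ℕ
  /-- the node that an arc leaves -/
  tail : Fin m → Fin n
  /-- the node that an arc enters -/
  head : Fin m → Fin n
  loopless : ∀ e, tail e ≠ head e

namespace FinDigraph

variable (G : FinDigraph)

/-- A nonempty closed directed walk, as the cyclic list of its arcs. -/
def IsClosedDiwalk (c : List (Fin G.m)) : Prop :=
  c ≠ [] ∧ Cycle.Chain (fun e f => G.head e = G.tail f) (c : Cycle (Fin G.m))

/-- `G` is Eulerian: a closed directed walk uses every arc exactly once. -/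
def IsEulerian : Prop :=
  ∃ c : List (Fin G.m), G.IsClosedDiwalk c ∧ c.Nodup ∧ ∀ e, e ∈ c

/-- Every node has in-degree 2 and out-degree 2. -/
def IsTwoInTwoOut : Prop :=
  ∀ v, (Finset.univ.filter fun e => G.head e = v).card = 2 ∧
    (Finset.univ.filter fun e => G.tail e = v).card = 2

/-- A (simple) Hamiltonian dicycle: a closed directed walk that visits every node exactly once. -/
def IsHamiltonianDicycle (c : List (Fin G.m)) : Prop :=
  G.IsClosedDiwalk c ∧ (c.map G.tail).Nodup ∧ ∀ v, v ∈ c.map G.tail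

/-- The arcs of `G` are partitioned into the arcs of two Hamiltonian dicycles. -/
def DecomposesIntoTwoHamiltonianDicycles : Prop :=
  ∃ c₁ c₂ : List (Fin G.m), G.IsHamiltonianDicycle c₁ ∧ G.IsHamiltonianDicycle c₂ ∧
    ∀ e, (e ∈ c₁ ∧ e ∉ c₂) ∨ (e ∉ c₁ ∧ e ∈ c₂)

/-- The oriented node-arc incidence matrix. -/
def incidence : Matrix (Fin G.n) (Fin G.m) ℚ :=
  Matrix.of fun v e => (if G.head e = v then 1 else 0) - (if G.tail e = v then 1 else 0)

/-- The 0/1-circulation polytope on `G`, that is `A_G x = 0`, `0 ≤ x ≤ 1`, where the bounds are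
the rows `x ≤ 1` followed by the rows `-x ≤ 0`. -/
def circulationPolytope : RatPolyhedron G.m where
  numEq := G.n
  numIneq := G.m + G.m
  A := G.incidence
  b := fun _ => 0
  B := Matrix.of (Fin.append (fun i => (1 : Matrix (Fin G.m) (Fin G.m) ℚ) i)
    (fun i => (-1 : Matrix (Fin G.m) (Fin G.m) ℚ) i))
  d := Fin.append (fun _ => 1) (fun _ => 0)

theorem mem_circulationPolytope {z : Fin G.m → ℝ} :
    z ∈ G.circulationPolytope.toSet ↔
      G.circulationPolytope.realA *ᵥ z = 0 ∧ ∀ e, 0 ≤ z e ∧ z e ≤ 1 := by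
  have hb : castVec G.circulationPolytope.b = 0 := by
    funext i; simp [castVec, circulationPolytope]
  have h1 : ∀ e : Fin G.m, (G.circulationPolytope.realB *ᵥ z) (Fin.castAdd G.m e) = z e := by
    intro e
    simp only [RatPolyhedron.realB, circulationPolytope, Matrix.mulVec, dotProduct,
      Matrix.map_apply, Matrix.of_apply, Fin.append_left]
    simp [Matrix.one_apply, apply_ite (fun q : ℚ => (q : ℝ))]
  have h2 : ∀ e : Fin G.m, (G.circulationPolytope.realB *ᵥ z) (Fin.natAdd G.m e) = - z e := by
    intro e
    simp only [RatPolyhedron.realB, circulationPolytope, Matrix.mulVec, dotProduct,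
      Matrix.map_apply, Matrix.of_apply, Fin.append_right]
    simp [Matrix.one_apply, apply_ite (fun q : ℚ => (q : ℝ))]
  have h3 : ∀ e : Fin G.m, castVec G.circulationPolytope.d (Fin.castAdd G.m e) = 1 := by
    intro e; simp [castVec, circulationPolytope]
  have h4 : ∀ e : Fin G.m, castVec G.circulationPolytope.d (Fin.natAdd G.m e) = 0 := by
    intro e; simp only [castVec, circulationPolytope, Fin.append_right, Rat.cast_zero]
  unfold RatPolyhedron.toSet
  rw [Set.mem_ofPred_eq, hb]
  refine and_congr Iff.rfl ⟨fun h e => ?_, fun h i => ?_⟩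
  · have a1 := h (Fin.castAdd G.m e)
    have a2 := h (Fin.natAdd G.m e)
    rw [h1, h3] at a1
    rw [h2, h4] at a2
    exact ⟨by linarith, a1⟩
  · change Fin (G.m + G.m) at i
    refine Fin.addCases (motive := fun i => (G.circulationPolytope.realB *ᵥ z) i ≤
      castVec G.circulationPolytope.d i) (fun e => ?_) (fun e => ?_) i
    · rw [h1, h3]; exact (h e).2
    · rw [h2, h4]; linarith [(h e).1]

/-- The zero flow is a vertex. -/
theorem isVertex_zero : G.circulationPolytope.IsVertex (castVec fun _ => 0) := by
  have h0 : castVec (fun _ : Fin G.m => (0 : ℚ)) = 0 := by funext e; simp [castVec]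
  rw [h0]
  refine ⟨(G.mem_circulationPolytope).2 ⟨by simp, fun e => by simp⟩, ?_⟩
  intro u hu v hv huv
  obtain ⟨s, t, hs, ht, -, he⟩ := huv
  funext e
  have := congrFun he e
  simp only [Pi.add_apply, Pi.smul_apply, smul_eq_mul, Pi.zero_apply] at this ⊢
  have h1 := ((G.mem_circulationPolytope.1 hu).2 e).1
  have h2 := ((G.mem_circulationPolytope.1 hv).2 e).1
  nlinarith [mul_nonneg hs.le h1, mul_nonneg ht.le h2]

/-- The full flow is a vertex when all in-degrees and out-degrees are 2. -/
theorem isVertex_one (hG : G.IsTwoInTwoOut) :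
    G.circulationPolytope.IsVertex (castVec fun _ => 1) := by
  have h0 : castVec (fun _ : Fin G.m => (1 : ℚ)) = fun _ => 1 := by funext e; simp [castVec]
  rw [h0]
  refine ⟨(G.mem_circulationPolytope).2 ⟨?_, fun e => by simp⟩, ?_⟩
  · funext v
    change Fin G.n at v
    obtain ⟨hin, hout⟩ := hG v
    simp [RatPolyhedron.realA, circulationPolytope, Matrix.mulVec, dotProduct, incidence,
      apply_ite (fun q : ℚ => (q : ℝ)), hin, hout]
    rfl
  · intro u hu v hv huv
    obtain ⟨s, t, hs, ht, hst, he⟩ := huv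
    funext e
    have := congrFun he e
    simp only [Pi.add_apply, Pi.smul_apply, smul_eq_mul] at this ⊢
    have h1 := ((G.mem_circulationPolytope.1 hu).2 e).2
    have h2 := ((G.mem_circulationPolytope.1 hv).2 e).2
    nlinarith [mul_nonneg hs.le (sub_nonneg.2 h1), mul_nonneg ht.le (sub_nonneg.2 h2)]

end FinDigraph

/-- The Eulerian digraphs in which every node has in-degree and out-degree 2. -/
def TwoRegularEulerianDigraph : Type := {G : FinDigraph // G.IsEulerian ∧ G.IsTwoInTwoOut}

/-- The alphabet for digraphs. -/
inductive DigraphLetter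
  | stroke
  | comma
  deriving DecidableEq

instance instFintypeDigraphLetter : Fintype DigraphLetter :=
  ⟨{DigraphLetter.stroke, DigraphLetter.comma}, fun x => by cases x <;> simp⟩

/-- The number `k` as `k` strokes. -/
def encUnary (k : ℕ) : List DigraphLetter := List.replicate k DigraphLetter.stroke

/-- A list of numbers, every one ended by a comma. -/
def encNumbers (l : List ℕ) : List DigraphLetter :=
  l.flatMap fun k => encUnary k ++ [DigraphLetter.comma]

/-- The word that encodes a digraph: the number of nodes, then the list of arcs, every arc as its
tail and its head. Nodes are written in unary; since a digraph with all in-degrees 2 has twice as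
many arcs as nodes, the length is at most quadratic in that of the binary version. -/
def encDigraph (G : FinDigraph) : List DigraphLetter :=
  encNumbers [G.n] ++ (List.ofFn fun e =>
    encNumbers [(G.tail e : ℕ), (G.head e : ℕ)]).flatten

theorem encNumbers_injective : Function.Injective encNumbers := by
  have hd : SelfDelimiting fun k : ℕ => encUnary k ++ [DigraphLetter.comma] :=
    SelfDelimiting.of_injective
      (fun a b h => by simpa [encUnary] using congrArg List.length h)
      (fun a h => by simp [encUnary] at h)
  intro l
  induction l with
  | nil =>
    intro l' h
    cases l' with
    | nil => rfl
    | cons a l' => simp [encNumbers] at h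
  | cons a l ih =>
    intro l' h
    cases l' with
    | nil => simp [encNumbers] at h
    | cons a' l' =>
      obtain ⟨h1, h2⟩ := hd a a' (encNumbers l) (encNumbers l') h
      rw [h1, ih h2]

theorem encDigraph_injective : Function.Injective encDigraph := by
  have hpair : ∀ L : List (ℕ × ℕ), (L.map fun p => encNumbers [p.1, p.2]).flatten =
      encNumbers (L.flatMap fun p => [p.1, p.2]) := by
    intro L
    rw [encNumbers, List.flatMap_assoc]
    rfl
  have hinj : ∀ L L' : List (ℕ × ℕ), (L.flatMap fun p => [p.1, p.2]) =
      (L'.flatMap fun p => [p.1, p.2]) → L = L' := by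
    intro L
    induction L with
    | nil => intro L' h; cases L' <;> simp_all
    | cons p L ih =>
      intro L' h
      cases L' with
      | nil => simp at h
      | cons p' L' =>
        simp only [List.flatMap_cons, List.cons_append, List.nil_append, List.cons.injEq] at h
        rw [ih L' h.2.2, Prod.ext h.1 h.2.1]
  have hform : ∀ G : FinDigraph, encDigraph G = encNumbers (G.n ::
      (List.ofFn fun e => ((G.tail e : ℕ), (G.head e : ℕ))).flatMap fun p => [p.1, p.2]) := by
    intro G
    have : (List.ofFn fun e => encNumbers [(G.tail e : ℕ), (G.head e : ℕ)]) =
        (List.ofFn fun e => ((G.tail e : ℕ), (G.head e : ℕ))).map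
          fun p => encNumbers [p.1, p.2] := by
      rw [List.map_ofFn]; rfl
    rw [encDigraph, this, hpair]
    simp [encNumbers]
  rintro G G' h
  rw [hform, hform] at h
  have h := encNumbers_injective h
  rw [List.cons.injEq] at h
  obtain ⟨hn, h⟩ := h
  have h := hinj _ _ h
  obtain ⟨n, m, t, hd, hl⟩ := G
  obtain ⟨n', m', t', hd', hl'⟩ := G'
  have hm : m = m' := by simpa using congrArg List.length h
  simp only at hn
  subst hn hm
  have h := List.ofFn_injective h
  have e1 : t = t' := funext fun e => Fin.ext (congrArg Prod.fst (congrFun h e))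
  have e2 : hd = hd' := funext fun e => Fin.ext (congrArg Prod.snd (congrFun h e))
  subst e1 e2
  rfl

/-- The problem: can a given Eulerian digraph, with in-degree and out-degree 2 at every node, be
decomposed into two Hamiltonian dicycles? -/
def twoHamiltonianDicycles : DecisionProblem where
  Instance := TwoRegularEulerianDigraph
  Letter := DigraphLetter
  encoding := encodingOfInjective (fun G => encDigraph G.1)
    (encDigraph_injective.comp Subtype.val_injective)
  Yes := fun G => G.1.DecomposesIntoTwoHamiltonianDicycles

/-- The Circ-Dist instance of a digraph: the 0/1-circulation polytope, the zero flow, the full flow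
and `k = 2`. -/
def zeroToFullFlow (G : TwoRegularEulerianDigraph) : CircDistInstance where
  n := G.1.m
  P := G.1.circulationPolytope
  x := fun _ => 0
  y := fun _ => 1
  k := 2
  isVertex_x := G.1.isVertex_zero
  isVertex_y := G.1.isVertex_one G.2.2

end CircuitDistance

end

/-!
The proof has two independent halves.

*The answer is preserved.* A nonnegative circuit `g` of the circulation polytope is the indicator
vector of a simple dicycle (`exists_eq_arcIndicator_of_isCircuit`): following arcs with positive
flow until a node repeats gives a simple dicycle inside the support of `g`, and subtracting a
multiple of it from `g` would contradict the minimality of the support unless nothing remains;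
coprimality then fixes the multiple. Conversely, indicator vectors of simple dicycles are circuits
(`IsSimpleDicycle.isCircuit`). In a walk of at most two steps from the zero flow to the full flow
both circuits are nonnegative, and maximality forces the first step length to be 1
(`exists_dicycle_of_first_step`). So the two circuits are complementary simple dicycles; as every
node has two outgoing arcs and a simple dicycle uses at most one of them, both dicycles are
Hamiltonian, and one dicycle alone can never reach the full flow.

*The map is computable in polynomial time.* The machine keeps a working tape, split into two
stacks, and passes over it back and forth as a finite-state transducer. For the incidence matrix,
the ends of all arcs stand on the tape in unary. The pass for node `v` takes one stroke off each
of them and crosses out those that have no stroke left, which are the ends equal to `v`; this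
gives a row of the matrix (`transduce_nodeTape`). For the inequality matrix, the tape
holds one cell for each arc, and the pass for row `i` flips the first cell that has not been
flipped, which is the place of the diagonal entry (`transduce_row`). The number of passes is
linear in the length of the input and so is the length of the tape, hence the running time is
quadratic (`machine_outputs`).
-/

namespace CircuitDistance

namespace FinDigraph

variable (G : FinDigraph)

/-! ### Simple dicycles and circulations -/

/-- A simple dicycle, as the cyclic list of its arcs: a nonempty closed directed walk that leaves
every node at most once. -/
def IsSimpleDicycle (c : List (Fin G.m)) : Prop :=
  G.IsClosedDiwalk c ∧ (c.map G.tail).Nodup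

/-- The indicator vector of the set of arcs in a list. -/
def arcIndicator (c : List (Fin G.m)) : Fin G.m → ℝ := fun e => if e ∈ c then 1 else 0

variable {G}

theorem IsSimpleDicycle.nodup {c : List (Fin G.m)} (hc : G.IsSimpleDicycle c) : c.Nodup :=
  List.Nodup.of_map _ hc.2

theorem realA_mulVec_apply (z : Fin G.m → ℝ) (v : Fin G.n) :
    (G.circulationPolytope.realA *ᵥ z) v =
      (∑ e, if G.head e = v then z e else 0) - ∑ e, if G.tail e = v then z e else 0 := by
  simp [RatPolyhedron.realA, circulationPolytope, Matrix.mulVec, dotProduct, incidence,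
    apply_ite (fun q : ℚ => (q : ℝ)), sub_mul, Finset.sum_sub_distrib, ite_mul]

theorem realA_mulVec_eq_zero_iff {z : Fin G.m → ℝ} :
    G.circulationPolytope.realA *ᵥ z = 0 ↔
      ∀ v, (∑ e, if G.head e = v then z e else 0) = ∑ e, if G.tail e = v then z e else 0 := by
  rw [funext_iff]
  exact forall_congr' fun v => by
    change (G.circulationPolytope.realA *ᵥ z) (v : Fin G.n) = 0 ↔ _
    exact (realA_mulVec_apply z v).congr_left.trans sub_eq_zero

theorem map_head_eq_map_tail_of_isChain :
    ∀ (a b : Fin G.m) (l : List (Fin G.m)),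
      List.IsChain (fun e f => G.head e = G.tail f) (a :: (l ++ [b])) →
      (a :: l).map G.head = (l ++ [b]).map G.tail
  | a, b, [], h => by simpa using h
  | a, b, x :: l, h => by
      rw [List.cons_append, List.isChain_cons_cons] at h
      have := map_head_eq_map_tail_of_isChain x b l h.2
      rw [List.map_cons, this, h.1]
      simp

theorem IsClosedDiwalk.map_head_perm {c : List (Fin G.m)} (hc : G.IsClosedDiwalk c) :
    (c.map G.head).Perm (c.map G.tail) := by
  obtain ⟨hne, hch⟩ := hc
  obtain ⟨a, l, rfl⟩ := List.exists_cons_of_ne_nil hne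
  rw [Cycle.chain_coe_cons] at hch
  rw [map_head_eq_map_tail_of_isChain a a l hch, List.map_append, List.map_cons]
  exact List.perm_append_comm

theorem sum_ite_arcIndicator {c : List (Fin G.m)} (hc : c.Nodup) (p : Fin G.m → Fin G.n)
    (v : Fin G.n) :
    (∑ e, if p e = v then G.arcIndicator c e else 0) =
      ((c.map p).map fun u => if u = v then (1 : ℝ) else 0).sum := by
  rw [List.map_map, ← List.sum_toFinset _ hc, ← Finset.sum_subset (Finset.subset_univ c.toFinset)]
  · refine Finset.sum_congr rfl fun e he => ?_
    simp [arcIndicator, List.mem_toFinset.1 he]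
  · intro e _ he
    simp [arcIndicator, mt List.mem_toFinset.2 he]

theorem IsSimpleDicycle.realA_mulVec_arcIndicator {c : List (Fin G.m)}
    (hc : G.IsSimpleDicycle c) : G.circulationPolytope.realA *ᵥ G.arcIndicator c = 0 := by
  rw [realA_mulVec_eq_zero_iff]
  intro v
  rw [sum_ite_arcIndicator hc.nodup, sum_ite_arcIndicator hc.nodup]
  exact (hc.1.map_head_perm.map _).sum_eq

/-- A sum over the arcs at a node collapses when at most one of them carries flow. -/
theorem sum_ite_eq_of_injOn {c : List (Fin G.m)} {h : Fin G.m → ℝ} (hs : ∀ e, h e ≠ 0 → e ∈ c)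
    {p : Fin G.m → Fin G.n} (hp : (c.map p).Nodup) {e : Fin G.m} (he : e ∈ c) :
    (∑ f, if p f = p e then h f else 0) = h e := by
  rw [Finset.sum_eq_single e _ (by simp)]
  · simp
  · intro f _ hfe
    split_ifs with hpf
    · by_contra hf
      exact hfe (List.inj_on_of_nodup_map hp (hs f hf) he hpf)
    · rfl

/-- A circulation that lives on a simple dicycle is constant along it, so it vanishes as soon as
it vanishes on one of the arcs. -/
theorem IsSimpleDicycle.eq_zero_of_circulation {c : List (Fin G.m)} (hc : G.IsSimpleDicycle c)
    {h : Fin G.m → ℝ} (hA : G.circulationPolytope.realA *ᵥ h = 0) (hs : ∀ e, h e ≠ 0 → e ∈ c)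
    {e₀ : Fin G.m} (he₀ : e₀ ∈ c) (h0 : h e₀ = 0) : h = 0 := by
  have hheads : (c.map G.head).Nodup := hc.1.map_head_perm.nodup_iff.2 hc.2
  rw [realA_mulVec_eq_zero_iff] at hA
  have hstep : ∀ e ∈ c, ∀ f ∈ c, G.head e = G.tail f → h e = h f := by
    intro e he f hf hef
    rw [← sum_ite_eq_of_injOn hs hheads he, ← sum_ite_eq_of_injOn hs hc.2 hf, ← hef]
    exact hA _
  obtain ⟨a, l, rfl⟩ := List.exists_cons_of_ne_nil hc.1.1
  have hch := hc.1.2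
  rw [Cycle.chain_coe_cons] at hch
  have hch' : Cycle.Chain (fun e f => h e = h f) ((a :: l : List (Fin G.m)) : Cycle (Fin G.m)) := by
    rw [Cycle.chain_coe_cons]
    exact hch.imp_of_mem_imp fun e f he hf => hstep e (by simpa [or_comm] using he) f
      (by simpa [or_comm] using hf)
  have : IsTrans (Fin G.m) fun e f => h e = h f := ⟨fun _ _ _ => Eq.trans⟩
  rw [Cycle.chain_iff_pairwise] at hch'
  funext e
  by_contra he
  exact he ((hch' e (by simpa using hs e he) e₀ (by simpa using he₀)).trans h0)

/-- Every nonnegative nonzero circulation carries flow along some simple dicycle: follow arcs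
with positive flow until a node repeats. -/
theorem exists_isSimpleDicycle_of_circulation {g : Fin G.m → ℝ}
    (hA : G.circulationPolytope.realA *ᵥ g = 0) (hg : ∀ e, 0 ≤ g e) (hne : g ≠ 0) :
    ∃ c, G.IsSimpleDicycle c ∧ ∀ e ∈ c, g e ≠ 0 := by
  classical
  rw [realA_mulVec_eq_zero_iff] at hA
  let V := {v : Fin G.n // ∃ e, G.tail e = v ∧ g e ≠ 0}
  have hnext : ∀ e, g e ≠ 0 → ∃ f, G.tail f = G.head e ∧ g f ≠ 0 := by
    intro e he
    by_contra hcon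
    push Not at hcon
    have h1 : (∑ f, if G.tail f = G.head e then g f else 0) = 0 :=
      Finset.sum_eq_zero fun f _ => by
        split_ifs with hf
        · exact hcon f hf
        · rfl
    rw [← hA, Finset.sum_eq_zero_iff_of_nonneg fun f _ => by split_ifs <;> simp [hg]] at h1
    exact he (by simpa using h1 e (Finset.mem_univ e))
  choose out hout using fun v : V => v.2
  let next : V → V := fun v => ⟨G.head (out v), hnext _ (hout v).2⟩
  obtain ⟨e₀, he₀⟩ := Function.ne_iff.1 hne
  let v₀ : V := ⟨G.tail e₀, e₀, rfl, he₀⟩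
  obtain ⟨i, j, hij, heq⟩ := Finite.exists_ne_map_eq_of_infinite fun k : ℕ => next^[k] v₀
  wlog hlt : i < j generalizing i j
  · exact this j i hij.symm heq.symm (by omega)
  have hx : next^[i] v₀ ∈ Function.periodicPts next := by
    refine Function.mk_mem_periodicPts (n := j - i) (by omega) ?_
    rw [Function.IsPeriodicPt, Function.IsFixedPt, ← Function.iterate_add_apply,
      Nat.sub_add_cancel hlt.le]
    exact heq.symm
  have hlen := Function.periodicOrbit_length (f := next) (x := next^[i] v₀)
  have hnd := Function.nodup_periodicOrbit (f := next) (x := next^[i] v₀)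
  have hch : Cycle.Chain (fun u v => next u = v) (Function.periodicOrbit next (next^[i] v₀)) :=
    (Function.periodicOrbit_chain' _ hx).2 fun n => (Function.iterate_succ_apply' ..).symm
  have hpos := Function.minimalPeriod_pos_of_mem_periodicPts hx
  induction hL : Function.periodicOrbit next (next^[i] v₀) using Quotient.inductionOn with
  | _ L =>
  rw [hL] at hlen hnd hch
  have htail : (L.map out).map G.tail = L.map Subtype.val := by
    rw [List.map_map]
    exact List.map_congr_left fun v _ => (hout v).1
  refine ⟨L.map out, ⟨⟨?_, ?_⟩, ?_⟩, ?_⟩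
  · rintro h
    rw [List.map_eq_nil_iff] at h
    subst h
    simp at hlen
    omega
  · rw [← Cycle.map_coe, Cycle.chain_map]
    exact Cycle.Chain.imp (fun u v huv => by rw [(hout v).1, ← huv]) hch
  · rw [htail]
    exact (Cycle.nodup_coe_iff.1 hnd).map Subtype.val_injective
  · intro e he
    obtain ⟨v, -, rfl⟩ := List.mem_map.1 he
    exact (hout v).2

/-! ### Circuits of the circulation polytope -/

theorem support_realB_subset_iff {g h : Fin G.m → ℝ} :
    Function.support (G.circulationPolytope.realB *ᵥ h) ⊆
        Function.support (G.circulationPolytope.realB *ᵥ g) ↔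
      ∀ e, h e ≠ 0 → g e ≠ 0 := by
  have h1 : ∀ (z : Fin G.m → ℝ) (e : Fin G.m),
      (G.circulationPolytope.realB *ᵥ z) (Fin.castAdd G.m e) = z e := by
    intro z e
    simp only [RatPolyhedron.realB, circulationPolytope, Matrix.mulVec, dotProduct,
      Matrix.map_apply, Matrix.of_apply, Fin.append_left]
    simp [Matrix.one_apply, apply_ite (fun q : ℚ => (q : ℝ))]
  have h2 : ∀ (z : Fin G.m → ℝ) (e : Fin G.m),
      (G.circulationPolytope.realB *ᵥ z) (Fin.natAdd G.m e) = - z e := by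
    intro z e
    simp only [RatPolyhedron.realB, circulationPolytope, Matrix.mulVec, dotProduct,
      Matrix.map_apply, Matrix.of_apply, Fin.append_right]
    simp [Matrix.one_apply, apply_ite (fun q : ℚ => (q : ℝ))]
  have s1 : ∀ (z : Fin G.m → ℝ) (e : Fin G.m),
      (G.circulationPolytope.realB *ᵥ z) (Fin.castAdd G.m e) ≠ 0 ↔ z e ≠ 0 := fun z e => by
    rw [h1]
  have s2 : ∀ (z : Fin G.m → ℝ) (e : Fin G.m),
      (G.circulationPolytope.realB *ᵥ z) (Fin.natAdd G.m e) ≠ 0 ↔ z e ≠ 0 := fun z e => by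
    rw [h2, neg_ne_zero]
  refine ⟨fun hs e he => (s1 g e).1 (Function.mem_support.1
    (hs (Function.mem_support.2 ((s1 h e).2 he)))), fun hs i hi => ?_⟩
  rw [Function.mem_support] at hi ⊢
  change Fin (G.m + G.m) at i
  induction i using Fin.addCases with
  | left e => exact (s1 g e).2 (hs e ((s1 h e).1 hi))
  | right e => exact (s2 g e).2 (hs e ((s2 h e).1 hi))

theorem IsSimpleDicycle.isCircuit {c : List (Fin G.m)} (hc : G.IsSimpleDicycle c) :
    G.circulationPolytope.IsCircuit (G.arcIndicator c) := by
  obtain ⟨a, ha⟩ := List.exists_mem_of_ne_nil c hc.1.1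
  refine ⟨hc.realA_mulVec_arcIndicator, ?_, ?_, fun e => if e ∈ c then 1 else 0, ?_, ?_⟩
  · exact Function.ne_iff.2 ⟨a, by simp [arcIndicator, ha]⟩
  · intro h hA hne hss
    have hsub : ∀ e, h e ≠ 0 → e ∈ c := fun e he => by
      simpa [arcIndicator] using support_realB_subset_iff.1 hss.1 e he
    apply hss.2
    rw [support_realB_subset_iff]
    intro e he h0
    exact hne (hc.eq_zero_of_circulation hA hsub (by simpa [arcIndicator] using he) h0)
  · intro e
    simp [arcIndicator]
  · have h1 := Finset.gcd_dvd (s := Finset.univ) (f := fun e => if e ∈ c then (1 : ℤ) else 0)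
      (Finset.mem_univ a)
    rw [if_pos ha] at h1
    rw [← Finset.normalize_gcd]
    exact normalize_eq_one.2 (isUnit_of_dvd_one h1)

/-- The nonnegative circuits are the indicator vectors of simple dicycles. -/
theorem exists_eq_arcIndicator_of_isCircuit {g : Fin G.m → ℝ}
    (hg : G.circulationPolytope.IsCircuit g) (h0 : ∀ e, 0 ≤ g e) :
    ∃ c, G.IsSimpleDicycle c ∧ g = G.arcIndicator c := by
  obtain ⟨hA, hne, hmin, z, hz, hgcd⟩ := hg
  obtain ⟨c, hc, hcg⟩ := exists_isSimpleDicycle_of_circulation hA h0 hne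
  obtain ⟨a, ha⟩ := List.exists_mem_of_ne_nil c hc.1.1
  -- Subtracting the right multiple of the dicycle kills the arc `a`, so the difference has
  -- smaller support than the circuit `g`.
  have hd : g - g a • G.arcIndicator c = 0 := by
    by_contra hd
    refine hmin (g - g a • G.arcIndicator c) ?_ hd ⟨?_, ?_⟩
    · rw [Matrix.mulVec_sub, Matrix.mulVec_smul, hA, hc.realA_mulVec_arcIndicator]
      simp
    · rw [support_realB_subset_iff]
      intro e he hge
      apply he
      have : e ∉ c := fun h => hcg e h hge
      simp [hge, arcIndicator, this]
    · rw [support_realB_subset_iff]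
      intro hs
      exact hs a (hcg a ha) (by simp [arcIndicator, ha])
  rw [sub_eq_zero] at hd
  refine ⟨c, hc, ?_⟩
  have hdvd : z a ∣ 1 := by
    rw [← hgcd]
    refine Finset.dvd_gcd fun e _ => ?_
    by_cases he : e ∈ c
    · have := congrFun hd e
      simp only [hz, Pi.smul_apply, arcIndicator, if_pos he, smul_eq_mul, mul_one] at this
      rw [Int.cast_injective this]
    · have := congrFun hd e
      simp only [hz, Pi.smul_apply, arcIndicator, if_neg he, smul_eq_mul, mul_zero] at this
      rw [Int.cast_eq_zero.1 this]
      exact dvd_zero _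
  have hpos : 0 ≤ z a := by
    have := h0 a
    rw [hz] at this
    exact_mod_cast this
  have hone : z a = 1 := Int.eq_one_of_dvd_one hpos hdvd
  rw [hd, hz a, hone]
  simp

/-! ### Circuit walks from the zero flow to the full flow -/

theorem IsTwoInTwoOut.circulation_one (hG : G.IsTwoInTwoOut) :
    G.circulationPolytope.realA *ᵥ (fun _ => (1 : ℝ)) = 0 := by
  rw [realA_mulVec_eq_zero_iff]
  intro v
  obtain ⟨hin, hout⟩ := hG v
  simp [hin, hout]

/-- A simple dicycle uses at most one of the arcs that leave a node. -/
theorem IsSimpleDicycle.eq_of_tail_eq {c : List (Fin G.m)} (hc : G.IsSimpleDicycle c)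
    {e f : Fin G.m} (he : e ∈ c) (hf : f ∈ c) (h : G.tail e = G.tail f) : e = f :=
  List.inj_on_of_nodup_map hc.2 he hf h

/-- When two simple dicycles cover all arcs of a digraph with out-degrees 2, each visits every
node. -/
theorem IsSimpleDicycle.isHamiltonianDicycle (hG : G.IsTwoInTwoOut) {c c' : List (Fin G.m)}
    (hc : G.IsSimpleDicycle c) (hc' : G.IsSimpleDicycle c') (hcov : ∀ e, e ∈ c ∨ e ∈ c') :
    G.IsHamiltonianDicycle c := by
  refine ⟨hc.1, hc.2, fun v => ?_⟩
  obtain ⟨e, f, hef, hs⟩ := Finset.card_eq_two.1 (hG v).2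
  have he : G.tail e = v := by
    have : e ∈ Finset.univ.filter fun e => G.tail e = v := by simp [hs]
    simpa using this
  have hf : G.tail f = v := by
    have : f ∈ Finset.univ.filter fun e => G.tail e = v := by simp [hs]
    simpa using this
  by_cases hec : e ∈ c
  · exact List.mem_map.2 ⟨e, hec, he⟩
  · refine List.mem_map.2 ⟨f, (hcov f).resolve_right fun hfc => ?_, hf⟩
    exact hef (hc'.eq_of_tail_eq ((hcov e).resolve_left hec) hfc (he.trans hf.symm))

theorem IsHamiltonianDicycle.isSimpleDicycle {c : List (Fin G.m)}
    (hc : G.IsHamiltonianDicycle c) : G.IsSimpleDicycle c :=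
  ⟨hc.1, hc.2.1⟩

/-- From a point that is nonnegative on some arc of a dicycle, no step along the dicycle longer
than 1 stays in the polytope. -/
theorem add_smul_arcIndicator_notMem {x : Fin G.m → ℝ} {c : List (Fin G.m)} {e : Fin G.m}
    (he : e ∈ c) (hx : 0 ≤ x e) {t : ℝ} (ht : 1 < t) :
    x + t • G.arcIndicator c ∉ G.circulationPolytope.toSet := by
  intro h
  have := ((G.mem_circulationPolytope.1 h).2 e).2
  simp only [Pi.add_apply, Pi.smul_apply, arcIndicator, if_pos he, smul_eq_mul, mul_one] at this
  linarith

theorem exists_circuitWalk_of_decomposes (hG : G.IsTwoInTwoOut)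
    (h : G.DecomposesIntoTwoHamiltonianDicycles) :
    ∃ W, IsCircuitWalk G.circulationPolytope 0 (fun _ => 1) W ∧ W.length ≤ 2 := by
  obtain ⟨c₁, c₂, h₁, h₂, hpart⟩ := h
  have s₁ := h₁.isSimpleDicycle
  have s₂ := h₂.isSimpleDicycle
  have hsum : G.arcIndicator c₁ + G.arcIndicator c₂ = fun _ => 1 := by
    funext e
    rcases hpart e with ⟨ha, hb⟩ | ⟨ha, hb⟩ <;> simp [arcIndicator, ha, hb]
  obtain ⟨a₁, ha₁⟩ := List.exists_mem_of_ne_nil c₁ s₁.1.1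
  obtain ⟨a₂, ha₂⟩ := List.exists_mem_of_ne_nil c₂ s₂.1.1
  refine ⟨[(G.arcIndicator c₁, 1), (G.arcIndicator c₂, 1)], ⟨?_, ?_, ?_, ?_, ?_⟩, le_rfl⟩
  · intro s hs
    simp only [List.mem_cons, List.not_mem_nil, or_false] at hs
    rcases hs with rfl | rfl
    exacts [s₁.isCircuit, s₂.isCircuit]
  · intro s hs
    simp only [List.mem_cons, List.not_mem_nil, or_false] at hs
    rcases hs with rfl | rfl <;> exact one_pos
  · simpa [walkPoint] using hsum
  · intro j hj hj2
    simp only [List.length_cons, List.length_nil, zero_add, Nat.reduceAdd] at hj2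
    rw [G.mem_circulationPolytope]
    interval_cases j
    · have : walkPoint 0 [(G.arcIndicator c₁, (1 : ℝ)), (G.arcIndicator c₂, 1)] 1 =
          G.arcIndicator c₁ := by simp [walkPoint]
      rw [this]
      refine ⟨s₁.realA_mulVec_arcIndicator, fun e => ?_⟩
      unfold arcIndicator
      split_ifs <;> norm_num
    · have : walkPoint 0 [(G.arcIndicator c₁, (1 : ℝ)), (G.arcIndicator c₂, 1)] 2 =
          fun _ => 1 := by simpa [walkPoint] using hsum
      rw [this]
      exact ⟨hG.circulation_one, fun e => by norm_num⟩
  · intro j hj t ht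
    simp only [List.length_cons, List.length_nil, zero_add, Nat.reduceAdd] at hj
    interval_cases j
    · exact add_smul_arcIndicator_notMem ha₁ (by simp [walkPoint]) ht
    · refine add_smul_arcIndicator_notMem ha₂ ?_ ht
      have : 0 ≤ G.arcIndicator c₁ a₂ := by unfold arcIndicator; split_ifs <;> norm_num
      simpa [walkPoint] using this

/-- A feasible maximal step along a nonnegative circuit from the zero flow has length 1 and
follows a simple dicycle. -/
theorem exists_dicycle_of_first_step {g : Fin G.m → ℝ} {t : ℝ}
    (hg : G.circulationPolytope.IsCircuit g) (ht : 0 < t)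
    (hfeas : t • g ∈ G.circulationPolytope.toSet)
    (hmax : ∀ s, t < s → s • g ∉ G.circulationPolytope.toSet) :
    t = 1 ∧ ∃ c, G.IsSimpleDicycle c ∧ g = G.arcIndicator c := by
  have hf := (G.mem_circulationPolytope.1 hfeas).2
  have h0 : ∀ e, 0 ≤ g e := fun e => nonneg_of_mul_nonneg_right (hf e).1 ht
  obtain ⟨c, hc, rfl⟩ := exists_eq_arcIndicator_of_isCircuit hg h0
  obtain ⟨a, ha⟩ := List.exists_mem_of_ne_nil c hc.1.1
  have hle : t ≤ 1 := by simpa [arcIndicator, ha] using (hf a).2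
  refine ⟨hle.antisymm (not_lt.1 fun hlt => hmax 1 hlt ?_), c, hc, rfl⟩
  rw [one_smul, G.mem_circulationPolytope]
  refine ⟨hc.realA_mulVec_arcIndicator, fun e => ?_⟩
  unfold arcIndicator
  split_ifs <;> norm_num

theorem decomposes_of_circuitWalk (hE : G.IsEulerian) (hG : G.IsTwoInTwoOut)
    {W : List ((Fin G.m → ℝ) × ℝ)}
    (hW : IsCircuitWalk G.circulationPolytope 0 (fun _ => 1) W) (hlen : W.length ≤ 2) :
    G.DecomposesIntoTwoHamiltonianDicycles := by
  obtain ⟨c₀, hc₀, -, -⟩ := hE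
  obtain ⟨e₀, -⟩ := List.exists_mem_of_ne_nil c₀ hc₀.1
  obtain ⟨hcirc, hpos, hreach, hfeas, hmax⟩ := hW
  match W, hlen with
  | [], _ => simpa [walkPoint] using congrFun hreach e₀
  | (g, t) :: W', hlen =>
  have hfirst := exists_dicycle_of_first_step (g := g) (t := t) (hcirc _ List.mem_cons_self)
    (hpos _ List.mem_cons_self) (by simpa [walkPoint] using hfeas 1 le_rfl (by simp))
    (fun s hs => by
      have := hmax 0 (by simp) s hs
      simp only [List.getElem_cons_zero] at this
      simpa [walkPoint] using this)
  obtain ⟨rfl, c, hc, rfl⟩ := hfirst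
  match W', hlen with
  | [], _ =>
    -- A single dicycle contains only one of the two arcs that leave a node.
    have hall : ∀ e, e ∈ c := fun e => by
      simpa [walkPoint, arcIndicator] using congrFun hreach e
    obtain ⟨e, f, hef, hs⟩ := Finset.card_eq_two.1 (hG (G.tail e₀)).2
    have he : e ∈ Finset.univ.filter fun e => G.tail e = G.tail e₀ := by simp [hs]
    have hf : f ∈ Finset.univ.filter fun e => G.tail e = G.tail e₀ := by simp [hs]
    simp only [Finset.mem_filter, Finset.mem_univ, true_and] at he hf
    exact absurd (hc.eq_of_tail_eq (hall e) (hall f) (he.trans hf.symm)) hef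
  | [(g', t')], _ =>
    have ht' : 0 < t' := hpos (g', t') (by simp)
    have hsum : ∀ e, G.arcIndicator c e + t' * g' e = 1 := fun e => by
      simpa [walkPoint] using congrFun hreach e
    have h0 : ∀ e, 0 ≤ g' e := by
      intro e
      refine nonneg_of_mul_nonneg_right (a := t') ?_ ht'
      have := hsum e
      unfold arcIndicator at this
      split_ifs at this <;> linarith
    obtain ⟨c', hc', rfl⟩ :=
      exists_eq_arcIndicator_of_isCircuit (hcirc (g', t') (by simp)) h0
    have hpart : ∀ e, (e ∈ c ∧ e ∉ c') ∨ (e ∉ c ∧ e ∈ c') := by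
      intro e
      have := hsum e
      by_cases h1 : e ∈ c <;> by_cases h2 : e ∈ c' <;> simp [arcIndicator, h1, h2] at this ⊢
      exact ht'.ne' this
    exact ⟨c, c', hc.isHamiltonianDicycle hG hc' fun e => (hpart e).imp And.left And.right,
      hc'.isHamiltonianDicycle hG hc fun e => (hpart e).symm.imp And.right And.left, hpart⟩

end FinDigraph

/-- The reduction preserves the answer. -/
theorem decomposes_iff_yes (G : TwoRegularEulerianDigraph) :
    G.1.DecomposesIntoTwoHamiltonianDicycles ↔ (zeroToFullFlow G).Yes := by
  have h0 : castVec (zeroToFullFlow G).x = 0 := by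
    funext e
    simp [castVec, zeroToFullFlow]
  have h1 : castVec (zeroToFullFlow G).y = fun _ => 1 := by
    funext e
    simp [castVec, zeroToFullFlow]
  unfold CircDistInstance.Yes
  rw [h0, h1]
  exact ⟨FinDigraph.exists_circuitWalk_of_decomposes G.2.2,
    fun ⟨W, hW, hlen⟩ => FinDigraph.decomposes_of_circuitWalk G.2.1 G.2.2 hW hlen⟩

/-! ### Transducers -/

/-- The run of a finite-state transducer with two output words: the state after the input word
and what has been written on the two outputs. -/
def transduce {Q A B C : Type} (δ : Q → A → Q × List B × List C) :
    Q → List A → Q × List B × List C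
  | q, [] => (q, [], [])
  | q, a :: w =>
    ((transduce δ (δ q a).1 w).1, (δ q a).2.1 ++ (transduce δ (δ q a).1 w).2.1,
      (δ q a).2.2 ++ (transduce δ (δ q a).1 w).2.2)

section Transduce

variable {Q A B C : Type} {δ : Q → A → Q × List B × List C}

theorem transduce_append_of_eq {q q' q'' : Q} {u w : List A} {b b' : List B} {c c' : List C}
    (hu : transduce δ q u = (q', b, c)) (hw : transduce δ q' w = (q'', b', c')) :
    transduce δ q (u ++ w) = (q'', b ++ b', c ++ c') := by
  induction u generalizing q b c with
  | nil =>
    simp only [transduce, Prod.mk.injEq] at hu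
    obtain ⟨rfl, rfl, rfl⟩ := hu
    simpa using hw
  | cons a u ih =>
    simp only [transduce, Prod.mk.injEq] at hu
    obtain ⟨h1, rfl, rfl⟩ := hu
    have := ih (q := (δ q a).1) (Prod.ext h1 rfl)
    simp [transduce, this]

theorem transduce_flatMap {X : Type} {q : Q} {u : X → List A} {b : X → List B} {c : X → List C}
    {l : List X} (h : ∀ x ∈ l, transduce δ q (u x) = (q, b x, c x)) :
    transduce δ q (l.flatMap u) = (q, l.flatMap b, l.flatMap c) := by
  induction l with
  | nil => rfl
  | cons x l ih =>
    exact transduce_append_of_eq (h x List.mem_cons_self)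
      (ih fun y hy => h y (List.mem_cons_of_mem _ hy))

/-- A transducer that stays in the same state while it reads the same letter. -/
theorem transduce_replicate {q : Q} {a : A} {b : List B} {c : List C} (h : δ q a = (q, b, c))
    (k : ℕ) : transduce δ q (List.replicate k a) =
      (q, (List.replicate k b).flatten, (List.replicate k c).flatten) := by
  induction k with
  | zero => rfl
  | succ k ih => simp [List.replicate_succ, transduce, h, ih]

end Transduce

/-! ### The machine -/

/-- The letters of the working tape. At first the tape holds the nodes as `cell`s followed by the
two ends of every arc, each as a block of `stroke`s that is closed by `tailEnd` or `headEnd`;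
later it holds the arcs as `cell`s. The flag of a closing letter tells whether the node that the
block stands for has not been met yet; the flag of a cell tells whether the row of the cell is
still to be written. -/
inductive TapeLetter
  | cell (pending : Bool)
  | stroke
  | tailEnd (pending : Bool)
  | headEnd (pending : Bool)
  deriving DecidableEq, Fintype

/-- The stacks: the input, the two halves of the working tape, the output so far with its last
letter on top, and the output. -/
inductive StackIndex
  | input
  | left
  | right
  | written
  | output
  deriving DecidableEq

instance : Fintype StackIndex :=
  ⟨{.input, .left, .right, .written, .output}, fun k => by cases k <;> simp⟩

/-- The alphabets of the stacks. -/
@[reducible]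
def StackLetter : StackIndex → Type
  | .input => DigraphLetter
  | .left => TapeLetter
  | .right => TapeLetter
  | .written => LPLetter
  | .output => LPLetter

/-- What the machine expects while it reads the input. -/
inductive ReadState
  | nodes
  | tails
  | heads
  deriving DecidableEq

instance : Fintype ReadState :=
  ⟨{.nodes, .tails, .heads}, fun q => by cases q <;> simp⟩

/-- The states of the passes over the working tape from left to right. A pass that starts in
`findNode` writes a row of the incidence matrix; there `fresh` says that the block of an end has
just begun, and `tailHit` that the tail of the present arc is the node of the row. The pass
`toArcs` writes the right-hand side `b` and replaces nodes and blocks by one cell for each arc.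
The pass `row p` writes a row of the inequality matrix, namely a row of the identity matrix if
`p` holds and of its negative if not; there `found` says that the diagonal entry has been
written. The passes `ones` and `zeros` write one constant entry for each arc. -/
inductive ForwardState
  | findNode
  | tail (fresh : Bool)
  | head (tailHit fresh : Bool)
  | toArcs
  | row (p found : Bool)
  | ones
  | zeros
  deriving DecidableEq, Fintype

/-- The states of the passes over the working tape from right to left. The first two restore the
tape and find out whether a row is still to be written, the others write one constant entry for
each arc. -/
inductive BackwardState
  | nodes (more : Bool)
  | arcs (p more : Bool)
  | zeros
  | ones
  deriving DecidableEq, Fintype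

/-- The labels of the machine. -/
inductive Phase
  | read (q : ReadState)
  | forward (q : ForwardState)
  | backward (q : BackwardState)
  | flush
  deriving DecidableEq, Fintype

/-- The entry `0` of a list. -/
def zeroEntry : List LPLetter := [.slash, .bit true, .comma]

/-- The entry `1` of a list. -/
def oneEntry : List LPLetter := [.bit true, .slash, .bit true, .comma]

/-- The entry `-1` of a list. -/
def negOneEntry : List LPLetter := [.minus, .bit true, .slash, .bit true, .comma]

/-- The entry of the incidence matrix for a node and an arc, by whether the node is the tail and
whether it is the head. -/
def incidenceEntry : Bool → Bool → List LPLetter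
  | true, false => negOneEntry
  | false, true => oneEntry
  | _, _ => zeroEntry

/-- The transitions while the input is read: the next state, what goes to the tape, and what goes
to the output. -/
def readStep : ReadState → DigraphLetter → ReadState × List TapeLetter × List LPLetter
  | .nodes, .stroke => (.nodes, [.cell true], [])
  | .nodes, .comma => (.tails, [], [])
  | .tails, .stroke => (.tails, [.stroke], [])
  | .tails, .comma => (.heads, [.tailEnd true], [])
  | .heads, .stroke => (.heads, [.stroke], [])
  | .heads, .comma => (.tails, [.headEnd true], [])

/-- The transitions of the passes from left to right. A pass for a row of the incidence matrix
marks the first pending node and takes one stroke off every pending block, so that in the pass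
for node `v` the pending empty blocks are those of the ends equal to `v`. Transitions on letters
that never occur in a state are arbitrary. -/
def forwardStep : ForwardState → TapeLetter → ForwardState × List TapeLetter × List LPLetter
  | .findNode, .cell true => (.tail true, [.cell false], [])
  | .findNode, a => (.findNode, [a], [])
  | .tail fresh, .stroke => (.tail false, if fresh then [] else [.stroke], [])
  | .tail fresh, .tailEnd pending =>
    (.head (fresh && pending) true, [.tailEnd (pending && !fresh)], [])
  | .tail fresh, a => (.tail fresh, [a], [])
  | .head tailHit fresh, .stroke => (.head tailHit false, if fresh then [] else [.stroke], [])
  | .head tailHit fresh, .headEnd pending =>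
    (.tail true, [.headEnd (pending && !fresh)], incidenceEntry tailHit (fresh && pending))
  | .head tailHit fresh, a => (.head tailHit fresh, [a], [])
  | .toArcs, .cell _ => (.toArcs, [], zeroEntry)
  | .toArcs, .headEnd _ => (.toArcs, [.cell true], [])
  | .toArcs, _ => (.toArcs, [], [])
  | .row p found, a =>
    if !found && a = .cell p then
      (.row p true, [.cell !p], if p then oneEntry else negOneEntry)
    else (.row p found, [a], zeroEntry)
  | .ones, a => (.ones, [a], oneEntry)
  | .zeros, a => (.zeros, [a], zeroEntry)

/-- The transitions of the passes from right to left. -/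
def backwardStep : BackwardState → TapeLetter → BackwardState × List TapeLetter × List LPLetter
  | .nodes more, a => (.nodes (more || a = .cell true), [a], [])
  | .arcs p more, a => (.arcs p (more || a = .cell p), [a], [])
  | .zeros, a => (.zeros, [a], zeroEntry)
  | .ones, _ => (.ones, [], oneEntry)

/-- The end of a pass from left to right: the next phase and what goes to the output. -/
def forwardEnd : ForwardState → Phase × List LPLetter
  | .findNode => (.backward (.nodes false), [.semicolon])
  | .tail _ => (.backward (.nodes false), [.semicolon])
  | .head _ _ => (.backward (.nodes false), [.semicolon])
  | .toArcs => (.backward (.arcs true false), [.semicolon])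
  | .row p _ => (.backward (.arcs p false), [.semicolon])
  | .ones => (.backward .zeros, [])
  | .zeros => (.backward .ones, [.semicolon])

/-- The end of a pass from right to left: the next phase and what goes to the output. The rows of
the identity matrix leave all arc cells with the flag `false`, and the rows of its negative turn
the flags back. -/
def backwardEnd : BackwardState → Phase × List LPLetter
  | .nodes true => (.forward .findNode, [])
  | .nodes false => (.forward .toArcs, [.bar])
  | .arcs p true => (.forward (.row p false), [])
  | .arcs true false => (.forward (.row false false), [])
  | .arcs false false => (.forward .ones, [.bar])
  | .zeros => (.forward .zeros, [.semicolon])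
  | .ones => (.flush, [.semicolon, .bit false, .bit true])

/-- The end of the input: the next phase and what goes to the output. -/
abbrev readEnd : ReadState → Phase × List LPLetter := fun _ => (.backward (.nodes false), [])

/-- The reaction to the result of a pop: a transition of the transducer, or the end of the pass
when the stack is empty. -/
def react {Q A : Type} (δ : Q → A → Q × List TapeLetter × List LPLetter)
    (e : Q → Phase × List LPLetter) (phase : Q → Phase) (q : Q) :
    Option A → Phase × List TapeLetter × List LPLetter
  | none => ((e q).1, [], (e q).2)
  | some a => (phase (δ q a).1, (δ q a).2.1, (δ q a).2.2)

/-- The internal state of the machine: the letter popped last, in the component of its alphabet;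
all components are empty after a pop from an empty stack. -/
abbrev Register : Type := Option DigraphLetter × Option TapeLetter × Option LPLetter

open Turing.TM2 in
/-- Push the word that `f` reads off the internal state, of length at most `N`, with its first
letter on top; `d` is a filler that is never pushed. -/
def pushWord {K Λ σ : Type} {Γ : K → Type} (k : K) (d : Γ k) (f : σ → List (Γ k)) :
    ℕ → Stmt Γ Λ σ → Stmt Γ Λ σ
  | 0, s => s
  | N + 1, s => .branch (fun v => N < (f v).length)
      (.push k (fun v => (f v).getD N d) (pushWord k d f N s)) (pushWord k d f N s)

open Turing.TM2 in
theorem stepAux_pushWord {K Λ σ : Type} {Γ : K → Type} [DecidableEq K] (k : K) (d : Γ k)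
    (f : σ → List (Γ k)) (N : ℕ) (s : Stmt Γ Λ σ) (v : σ) (hf : (f v).length ≤ N)
    (S : ∀ k, List (Γ k)) :
    stepAux (pushWord k d f N s) v S = stepAux s v (Function.update S k (f v ++ S k)) := by
  suffices ∀ N (S : ∀ k, List (Γ k)), stepAux (pushWord k d f N s) v S =
      stepAux s v (Function.update S k ((f v).take N ++ S k)) by
    rw [this, List.take_of_length_le hf]
  clear hf
  intro N
  induction N with
  | zero => simp [pushWord]
  | succ N ih =>
    intro S
    by_cases hN : N < (f v).length
    · have htake : (f v).take (N + 1) = (f v).take N ++ [(f v).getD N d] := by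
        rw [List.take_succ_eq_append_getElem hN, List.getD_eq_getElem _ _ hN]
      simp only [pushWord, Turing.TM2.stepAux, hN, decide_true, cond_true, ih,
        Function.update_self, Function.update_idem, htake, List.append_assoc, List.singleton_append]
    · simp only [pushWord, Turing.TM2.stepAux, hN, decide_false, cond_false, ih,
        List.take_of_length_le (not_lt.1 hN),
        List.take_of_length_le (Nat.le_succ_of_le (not_lt.1 hN))]

/-- What follows the pop in a step of a pass: `μ` gives the next phase and the two words to be
written, `push` writes the first one on a half of the working tape. Every word is reversed, since
its last letter is to end up on top. -/
def reactStmt (μ : Register → Phase × List TapeLetter × List LPLetter)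
    (push : (Register → List TapeLetter) →
      Turing.TM2.Stmt StackLetter Phase Register → Turing.TM2.Stmt StackLetter Phase Register) :
    Turing.TM2.Stmt StackLetter Phase Register :=
  push (fun v => (μ v).2.1.reverse) <|
    pushWord (Γ := StackLetter) .written LPLetter.bar (fun v => (μ v).2.2.reverse) 5 <|
      .goto fun v => (μ v).1

/-- The program of the machine. The last phase moves the written word to the output stack, which
reverses it. -/
def program : Phase → Turing.TM2.Stmt StackLetter Phase Register
  | .read q => .pop .input (fun _ a => (a, none, none)) <|
      reactStmt (fun v => react readStep readEnd .read q v.1)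
        fun f => pushWord (Γ := StackLetter) .right TapeLetter.stroke f 1
  | .forward q => .pop .left (fun _ a => (none, a, none)) <|
      reactStmt (fun v => react forwardStep forwardEnd .forward q v.2.1)
        fun f => pushWord (Γ := StackLetter) .right TapeLetter.stroke f 1
  | .backward q => .pop .right (fun _ a => (none, a, none)) <|
      reactStmt (fun v => react backwardStep backwardEnd .backward q v.2.1)
        fun f => pushWord (Γ := StackLetter) .left TapeLetter.stroke f 1
  | .flush => .pop .written (fun _ a => (none, none, a)) <|
      .branch (fun v => v.2.2.isNone) .halt <|
        .push .output (fun v => (v.2.2.getD LPLetter.bar : LPLetter)) <| .goto fun _ => .flush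

/-- The contents of the five stacks. -/
def stackContents (i : List DigraphLetter) (l r : List TapeLetter) (w o : List LPLetter) :
    ∀ k, List (StackLetter k)
  | .input => i
  | .left => l
  | .right => r
  | .written => w
  | .output => o

section Stacks

variable (i i' : List DigraphLetter) (l l' r r' : List TapeLetter) (w w' o o' : List LPLetter)

theorem update_input : Function.update (stackContents i l r w o) .input i' =
    stackContents i' l r w o := by
  funext k; cases k <;> rfl

theorem update_left : Function.update (stackContents i l r w o) .left l' =
    stackContents i l' r w o := by
  funext k; cases k <;> rfl

theorem update_right : Function.update (stackContents i l r w o) .right r' =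
    stackContents i l r' w o := by
  funext k; cases k <;> rfl

theorem update_written : Function.update (stackContents i l r w o) .written w' =
    stackContents i l r w' o := by
  funext k; cases k <;> rfl

theorem update_output : Function.update (stackContents i l r w o) .output o' =
    stackContents i l r w o' := by
  funext k; cases k <;> rfl

end Stacks

instance (k : StackIndex) : Fintype (StackLetter k) := by
  cases k <;> unfold StackLetter <;> infer_instance

/-- The machine that computes the reduction, with finite alphabets on all stacks. -/
def machine : Turing.FinTM2 where
  K := StackIndex
  k₀ := .input
  k₁ := .output
  Γ := StackLetter
  Λ := Phase
  main := .read .nodes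
  σ := Register
  initialState := (none, none, none)
  m := program

theorem length_readStep (q : ReadState) (a : DigraphLetter) :
    (readStep q a).2.1.length ≤ 1 ∧ (readStep q a).2.2.length ≤ 5 := by
  cases q <;> cases a <;> simp [readStep]

theorem length_incidenceEntry (s t : Bool) : (incidenceEntry s t).length ≤ 5 := by
  cases s <;> cases t <;> simp [incidenceEntry, zeroEntry, oneEntry, negOneEntry]

theorem length_forwardStep (q : ForwardState) (a : TapeLetter) :
    (forwardStep q a).2.1.length ≤ 1 ∧ (forwardStep q a).2.2.length ≤ 5 := by
  revert q a; decide

theorem length_backwardStep (q : BackwardState) (a : TapeLetter) :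
    (backwardStep q a).2.1.length ≤ 1 ∧ (backwardStep q a).2.2.length ≤ 5 := by
  revert q a; decide

theorem length_forwardEnd (q : ForwardState) : (forwardEnd q).2.length ≤ 5 := by
  revert q; decide

theorem length_backwardEnd (q : BackwardState) : (backwardEnd q).2.length ≤ 5 := by
  revert q; decide

/-! ### Runs of the machine -/

/-- Within `t` steps the machine gets from phase `p` with stacks `S` to phase `p'` with stacks
`S'`, whatever letter was popped last. -/
def Reaches (t : ℕ) (p : Phase) (S : ∀ k, List (StackLetter k)) (p' : Phase)
    (S' : ∀ k, List (StackLetter k)) : Prop :=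
  ∀ v : Register, ∃ v' : Register, ∃ n ≤ t,
    (fun c => Option.bind c (Turing.TM2.step program))^[n] (some ⟨some p, v, S⟩) =
      some ⟨some p', v', S'⟩

theorem Reaches.trans {t t' : ℕ} {p p' p'' : Phase} {S S' S'' : ∀ k, List (StackLetter k)}
    (h : Reaches t p S p' S') (h' : Reaches t' p' S' p'' S'') : Reaches (t + t') p S p'' S'' := by
  intro v
  obtain ⟨v', n, hn, e⟩ := h v
  obtain ⟨v'', n', hn', e'⟩ := h' v'
  refine ⟨v'', n' + n, by omega, ?_⟩
  rw [Function.iterate_add_apply, e, e']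

theorem Reaches.mono {t t' : ℕ} {p p' : Phase} {S S' : ∀ k, List (StackLetter k)}
    (h : Reaches t p S p' S') (htt : t ≤ t') : Reaches t' p S p' S' := fun v => by
  obtain ⟨v', n, hn, e⟩ := h v
  exact ⟨v', n, hn.trans htt, e⟩

theorem Reaches.of_stepAux {p p' : Phase} {S S' : ∀ k, List (StackLetter k)} (v' : Register)
    (h : ∀ v : Register, Turing.TM2.stepAux (program p) v S = ⟨some p', v', S'⟩) :
    Reaches 1 p S p' S' :=
  fun v => ⟨v', 1, le_rfl, congrArg some (h v)⟩

theorem length_react {Q A : Type} {δ : Q → A → Q × List TapeLetter × List LPLetter}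
    {e : Q → Phase × List LPLetter} {phase : Q → Phase}
    (hδ : ∀ q a, (δ q a).2.1.length ≤ 1 ∧ (δ q a).2.2.length ≤ 5)
    (he : ∀ q, (e q).2.length ≤ 5) (q : Q) (o : Option A) :
    (react δ e phase q o).2.1.length ≤ 1 ∧ (react δ e phase q o).2.2.length ≤ 5 := by
  cases o with
  | none => exact ⟨Nat.zero_le _, he q⟩
  | some a => exact hδ q a

theorem reaches_of_react_read (q : ReadState) (i : List DigraphLetter)
    (l r : List TapeLetter) (w o : List LPLetter) :
    Reaches 1 (.read q) (stackContents i l r w o)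
      (react readStep readEnd .read q i.head?).1
      (stackContents i.tail l ((react readStep readEnd .read q i.head?).2.1.reverse ++ r)
        ((react readStep readEnd .read q i.head?).2.2.reverse ++ w) o) := by
  refine .of_stepAux (i.head?, none, none) fun v => ?_
  have h := length_react (e := readEnd) (phase := .read) length_readStep
    (fun _ => Nat.zero_le _) q i.head?
  simp only [program, reactStmt, Turing.TM2.stepAux]
  rw [stepAux_pushWord _ _ _ _ _ _ (by simpa [stackContents] using h.1),
    stepAux_pushWord _ _ _ _ _ _ (by simpa [stackContents] using h.2), update_input, update_right,
    update_written]
  rfl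

theorem reaches_of_react_forward (q : ForwardState) (i : List DigraphLetter)
    (l r : List TapeLetter) (w o : List LPLetter) :
    Reaches 1 (.forward q) (stackContents i l r w o)
      (react forwardStep forwardEnd .forward q l.head?).1
      (stackContents i l.tail ((react forwardStep forwardEnd .forward q l.head?).2.1.reverse ++ r)
        ((react forwardStep forwardEnd .forward q l.head?).2.2.reverse ++ w) o) := by
  refine .of_stepAux (none, l.head?, none) fun v => ?_
  have h := length_react (phase := .forward) length_forwardStep length_forwardEnd q l.head?
  simp only [program, reactStmt, Turing.TM2.stepAux]
  rw [stepAux_pushWord _ _ _ _ _ _ (by simpa [stackContents] using h.1),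
    stepAux_pushWord _ _ _ _ _ _ (by simpa [stackContents] using h.2), update_left, update_right,
    update_written]
  rfl

theorem reaches_of_react_backward (q : BackwardState) (i : List DigraphLetter)
    (l r : List TapeLetter) (w o : List LPLetter) :
    Reaches 1 (.backward q) (stackContents i l r w o)
      (react backwardStep backwardEnd .backward q r.head?).1
      (stackContents i ((react backwardStep backwardEnd .backward q r.head?).2.1.reverse ++ l)
        r.tail ((react backwardStep backwardEnd .backward q r.head?).2.2.reverse ++ w) o) := by
  refine .of_stepAux (none, r.head?, none) fun v => ?_
  have h := length_react (phase := .backward) length_backwardStep length_backwardEnd q r.head?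
  simp only [program, reactStmt, Turing.TM2.stepAux]
  rw [stepAux_pushWord _ _ _ _ _ _ (by simpa [stackContents] using h.1),
    stepAux_pushWord _ _ _ _ _ _ (by simpa [stackContents] using h.2), update_right, update_left,
    update_written]
  rfl

/-- A whole pass over the input. -/
theorem reaches_of_transduce_read {q q' : ReadState} {i : List DigraphLetter}
    {b : List TapeLetter} {c : List LPLetter} (h : transduce readStep q i = (q', b, c))
    (r : List TapeLetter) (w : List LPLetter) :
    Reaches (i.length + 1) (.read q) (stackContents i [] r w.reverse [])
      (readEnd q').1
      (stackContents [] [] (b.reverse ++ r) (w ++ c ++ (readEnd q').2).reverse []) := by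
  induction i generalizing q b c r w with
  | nil =>
    simp only [transduce, Prod.mk.injEq] at h
    obtain ⟨rfl, rfl, rfl⟩ := h
    simpa [react] using reaches_of_react_read q [] [] r w.reverse []
  | cons a i ih =>
    simp only [transduce, Prod.mk.injEq] at h
    obtain ⟨h1, rfl, rfl⟩ := h
    have hs := reaches_of_react_read q (a :: i) [] r w.reverse []
    have ht := ih (q := (readStep q a).1) (Prod.ext h1 rfl) ((readStep q a).2.1.reverse ++ r)
      (w ++ (readStep q a).2.2)
    simp only [react, List.head?_cons, List.tail_cons, ← List.reverse_append] at hs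
    simpa [Nat.add_comm 1] using hs.trans ht

/-- A whole pass over the working tape from left to right. -/
theorem reaches_of_transduce_forward {q q' : ForwardState} {l : List TapeLetter}
    {b : List TapeLetter} {c : List LPLetter} (h : transduce forwardStep q l = (q', b, c))
    (r : List TapeLetter) (w : List LPLetter) :
    Reaches (l.length + 1) (.forward q) (stackContents [] l r w.reverse [])
      (forwardEnd q').1
      (stackContents [] [] (b.reverse ++ r) (w ++ c ++ (forwardEnd q').2).reverse []) := by
  induction l generalizing q b c r w with
  | nil =>
    simp only [transduce, Prod.mk.injEq] at h
    obtain ⟨rfl, rfl, rfl⟩ := h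
    simpa [react] using reaches_of_react_forward q [] [] r w.reverse []
  | cons a l ih =>
    simp only [transduce, Prod.mk.injEq] at h
    obtain ⟨h1, rfl, rfl⟩ := h
    have hs := reaches_of_react_forward q [] (a :: l) r w.reverse []
    have ht := ih (q := (forwardStep q a).1) (Prod.ext h1 rfl)
      ((forwardStep q a).2.1.reverse ++ r) (w ++ (forwardStep q a).2.2)
    simp only [react, List.head?_cons, List.tail_cons, ← List.reverse_append] at hs
    simpa [Nat.add_comm 1] using hs.trans ht

/-- A whole pass over the working tape from right to left. -/
theorem reaches_of_transduce_backward {q q' : BackwardState} {r : List TapeLetter}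
    {b : List TapeLetter} {c : List LPLetter} (h : transduce backwardStep q r = (q', b, c))
    (l : List TapeLetter) (w : List LPLetter) :
    Reaches (r.length + 1) (.backward q) (stackContents [] l r w.reverse [])
      (backwardEnd q').1
      (stackContents [] (b.reverse ++ l) [] (w ++ c ++ (backwardEnd q').2).reverse []) := by
  induction r generalizing q b c l w with
  | nil =>
    simp only [transduce, Prod.mk.injEq] at h
    obtain ⟨rfl, rfl, rfl⟩ := h
    simpa [react] using reaches_of_react_backward q [] l [] w.reverse []
  | cons a r ih =>
    simp only [transduce, Prod.mk.injEq] at h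
    obtain ⟨h1, rfl, rfl⟩ := h
    have hs := reaches_of_react_backward q [] l (a :: r) w.reverse []
    have ht := ih (q := (backwardStep q a).1) (Prod.ext h1 rfl)
      ((backwardStep q a).2.1.reverse ++ l) (w ++ (backwardStep q a).2.2)
    simp only [react, List.head?_cons, List.tail_cons, ← List.reverse_append] at hs
    simpa [Nat.add_comm 1] using hs.trans ht

/-- The last phase reverses what has been written, and halts in the initial internal state. -/
theorem iterate_step_flush (w o : List LPLetter) (v : Register) :
    (fun c => Option.bind c (Turing.TM2.step program))^[w.length + 1]
      (some ⟨some .flush, v, stackContents [] [] [] w o⟩) =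
      some ⟨none, (none, none, none), stackContents [] [] [] [] (w.reverse ++ o)⟩ := by
  induction w generalizing o v with
  | nil =>
    have h : Turing.TM2.stepAux (program .flush) v (stackContents [] [] [] [] o) =
      ⟨none, (none, none, none), Function.update (stackContents [] [] [] [] o) .written []⟩ := rfl
    rw [update_written] at h
    exact congrArg some h
  | cons a w ih =>
    have h : Turing.TM2.stepAux (program .flush) v (stackContents [] [] [] (a :: w) o) =
      ⟨some .flush, (none, none, some a), Function.update
        (Function.update (stackContents [] [] [] (a :: w) o) .written w) .output (a :: o)⟩ := rfl
    rw [update_written, update_output] at h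
    rw [List.length_cons, Function.iterate_succ_apply, Option.bind_some, Turing.TM2.step, h, ih]
    simp

/-! ### The tape during the passes -/

/-- The block for the end `t` of an arc before the pass for node `v`; `e` makes the closing
letter. -/
def endBlock (e : Bool → TapeLetter) (v t : ℕ) : List TapeLetter :=
  if v ≤ t then List.replicate (t - v) TapeLetter.stroke ++ [e true] else [e false]

/-- The blocks for the two ends of an arc before the pass for node `v`. -/
def arcBlock (v : ℕ) (a : ℕ × ℕ) : List TapeLetter :=
  endBlock .tailEnd v a.1 ++ endBlock .headEnd v a.2

/-- The tape for a digraph with `n` nodes and the list `l` of arcs before the pass for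
node `v`. -/
def nodeTape (n : ℕ) (l : List (ℕ × ℕ)) (v : ℕ) : List TapeLetter :=
  List.replicate v (TapeLetter.cell false) ++
    (List.replicate (n - v) (TapeLetter.cell true) ++ l.flatMap (arcBlock v))

/-- The tape for `m` arcs before the pass for row `i` of the identity matrix (if `p` holds) or of
its negative (if not). -/
def arcTape (m : ℕ) (p : Bool) (i : ℕ) : List TapeLetter :=
  List.replicate i (TapeLetter.cell !p) ++ List.replicate (m - i) (TapeLetter.cell p)

/-- A constant vector of length `k`, without the final semicolon. -/
def constantWord (c : List LPLetter) (k : ℕ) : List LPLetter := (List.replicate k c).flatten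

/-- The row of the incidence matrix for node `v`, without the final semicolon. -/
def incidenceRow (l : List (ℕ × ℕ)) (v : ℕ) : List LPLetter :=
  l.flatMap fun a => incidenceEntry (decide (a.1 = v)) (decide (a.2 = v))

/-- Row `i` of the identity matrix or of its negative, without the final semicolon. -/
def unitRow (m : ℕ) (p : Bool) (i : ℕ) : List LPLetter :=
  constantWord zeroEntry i ++ ((if p then oneEntry else negOneEntry) ++
    constantWord zeroEntry (m - i - 1))

theorem flatMap_nil_eq_nil {A B : Type} (l : List A) : l.flatMap (fun _ => ([] : List B)) = [] := by
  simp

theorem flatMap_singleton_eq_replicate {A B : Type} (l : List A) (b : B) :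
    l.flatMap (fun _ => [b]) = List.replicate l.length b := by
  induction l with
  | nil => rfl
  | cons a l ih => simp [ih, List.replicate_succ]

theorem transduce_stroke_tail (k : ℕ) :
    transduce forwardStep (.tail false) (List.replicate k TapeLetter.stroke) =
      (.tail false, List.replicate k TapeLetter.stroke, []) := by
  simpa using transduce_replicate (δ := forwardStep) (q := .tail false) (a := .stroke)
    (b := [.stroke]) (c := []) rfl k

theorem transduce_stroke_head (s : Bool) (k : ℕ) :
    transduce forwardStep (.head s false) (List.replicate k TapeLetter.stroke) =
      (.head s false, List.replicate k TapeLetter.stroke, []) := by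
  simpa using transduce_replicate (δ := forwardStep) (q := .head s false) (a := .stroke)
    (b := [.stroke]) (c := []) rfl k

theorem transduce_endBlock_tailEnd (v t : ℕ) :
    transduce forwardStep (.tail true) (endBlock .tailEnd v t) =
      (.head (decide (t = v)) true, endBlock .tailEnd (v + 1) t, []) := by
  rcases lt_trichotomy t v with h | rfl | h
  · simp [endBlock, transduce, forwardStep, not_le.2 h, not_le.2 (h.trans (Nat.lt_succ_self v)),
      h.ne]
  · simp [endBlock, transduce, forwardStep]
  · obtain ⟨k, rfl⟩ := Nat.exists_eq_add_of_lt h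
    have h1 : endBlock .tailEnd v (v + k + 1) =
        TapeLetter.stroke :: (List.replicate k TapeLetter.stroke ++ [TapeLetter.tailEnd true]) := by
      simp [endBlock, show v ≤ v + k + 1 by omega, show v + k + 1 - v = k + 1 by omega,
        List.replicate_succ]
    have h2 : endBlock .tailEnd (v + 1) (v + k + 1) =
        List.replicate k TapeLetter.stroke ++ [TapeLetter.tailEnd true] := by
      simp [endBlock, show v + k + 1 - (v + 1) = k by omega]
    have h3 : transduce forwardStep (.tail false)
        (List.replicate k TapeLetter.stroke ++ [TapeLetter.tailEnd true]) =
        (.head false true, List.replicate k TapeLetter.stroke ++ [TapeLetter.tailEnd true], []) :=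
      transduce_append_of_eq (transduce_stroke_tail k) rfl
    rw [h1, h2, transduce, show forwardStep (.tail true) .stroke = (.tail false, [], []) from rfl,
      h3]
    simp [show v + k + 1 ≠ v by omega]

theorem transduce_endBlock_headEnd (s : Bool) (v t : ℕ) :
    transduce forwardStep (.head s true) (endBlock .headEnd v t) =
      (.tail true, endBlock .headEnd (v + 1) t, incidenceEntry s (decide (t = v))) := by
  rcases lt_trichotomy t v with h | rfl | h
  · simp [endBlock, transduce, forwardStep, not_le.2 h, not_le.2 (h.trans (Nat.lt_succ_self v)),
      h.ne]
  · simp [endBlock, transduce, forwardStep]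
  · obtain ⟨k, rfl⟩ := Nat.exists_eq_add_of_lt h
    have h1 : endBlock .headEnd v (v + k + 1) =
        TapeLetter.stroke :: (List.replicate k TapeLetter.stroke ++ [TapeLetter.headEnd true]) := by
      simp [endBlock, show v ≤ v + k + 1 by omega, show v + k + 1 - v = k + 1 by omega,
        List.replicate_succ]
    have h2 : endBlock .headEnd (v + 1) (v + k + 1) =
        List.replicate k TapeLetter.stroke ++ [TapeLetter.headEnd true] := by
      simp [endBlock, show v + k + 1 - (v + 1) = k by omega]
    have h3 : transduce forwardStep (.head s false)
        (List.replicate k TapeLetter.stroke ++ [TapeLetter.headEnd true]) =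
        (.tail true, List.replicate k TapeLetter.stroke ++ [TapeLetter.headEnd true],
          incidenceEntry s false) :=
      transduce_append_of_eq (transduce_stroke_head s k) (by cases s <;> rfl)
    rw [h1, h2, transduce, show forwardStep (.head s true) .stroke = (.head s false, [], []) from
      rfl, h3]
    simp [show v + k + 1 ≠ v by omega]

theorem transduce_nodeTape (n : ℕ) (l : List (ℕ × ℕ)) {v : ℕ} (hv : v < n) :
    transduce forwardStep .findNode (nodeTape n l v) =
      (.tail true, nodeTape n l (v + 1), incidenceRow l v) := by
  obtain ⟨k, rfl⟩ := Nat.exists_eq_add_of_lt hv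
  have h1 := transduce_replicate (δ := forwardStep) (q := .findNode) (a := .cell false)
    (b := [TapeLetter.cell false]) (c := []) rfl v
  have h2 := transduce_replicate (δ := forwardStep) (q := .tail true) (a := .cell true)
    (b := [TapeLetter.cell true]) (c := []) rfl k
  have h3 := transduce_flatMap (l := l) (q := ForwardState.tail true) (δ := forwardStep)
    (u := arcBlock v) (b := arcBlock (v + 1))
    (c := fun a => incidenceEntry (decide (a.1 = v)) (decide (a.2 = v))) fun a _ => by
      have := transduce_append_of_eq (transduce_endBlock_tailEnd v a.1)
        (transduce_endBlock_headEnd (decide (a.1 = v)) v a.2)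
      simpa [arcBlock] using this
  have h4 : transduce forwardStep .findNode [TapeLetter.cell true] =
      (.tail true, [TapeLetter.cell false], []) := rfl
  have := transduce_append_of_eq h1 (transduce_append_of_eq h4 (transduce_append_of_eq h2 h3))
  simpa [nodeTape, incidenceRow, show v + k + 1 - v = k + 1 by omega,
    show v + k + 1 - (v + 1) = k by omega, List.replicate_succ (n := k),
    List.replicate_succ' (n := v),
    -List.replicate_append_replicate] using this

theorem transduce_backward_nodes (b : Bool) (r : List TapeLetter) :
    transduce backwardStep (.nodes b) r =
      (.nodes (b || decide (TapeLetter.cell true ∈ r)), r, []) := by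
  induction r generalizing b with
  | nil => simp [transduce]
  | cons a r ih =>
    simp [transduce, backwardStep, ih, Bool.or_assoc, eq_comm]

theorem transduce_backward_arcs (p b : Bool) (r : List TapeLetter) :
    transduce backwardStep (.arcs p b) r =
      (.arcs p (b || decide (TapeLetter.cell p ∈ r)), r, []) := by
  induction r generalizing b with
  | nil => simp [transduce]
  | cons a r ih =>
    simp [transduce, backwardStep, ih, Bool.or_assoc, eq_comm]

theorem transduce_toArcs_endBlock (v t : ℕ) :
    transduce forwardStep .toArcs (endBlock .tailEnd v t) = (.toArcs, [], []) ∧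
    transduce forwardStep .toArcs (endBlock .headEnd v t) =
      (.toArcs, [TapeLetter.cell true], []) := by
  have h (k : ℕ) : transduce forwardStep .toArcs (List.replicate k TapeLetter.stroke) =
      (.toArcs, [], []) := by
    simpa using transduce_replicate (δ := forwardStep) (q := .toArcs) (a := .stroke)
      (b := []) (c := []) rfl k
  unfold endBlock
  split_ifs
  · exact ⟨transduce_append_of_eq (h _) rfl, transduce_append_of_eq (h _) rfl⟩
  · exact ⟨rfl, rfl⟩

theorem transduce_toArcs (n : ℕ) (l : List (ℕ × ℕ)) :
    transduce forwardStep .toArcs (nodeTape n l n) =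
      (.toArcs, arcTape l.length true 0, constantWord zeroEntry n) := by
  have h1 := transduce_replicate (δ := forwardStep) (q := .toArcs) (a := .cell false)
    (b := []) (c := zeroEntry) rfl n
  have h3 := transduce_flatMap (l := l) (q := ForwardState.toArcs) (δ := forwardStep)
    (u := arcBlock n) (b := fun _ => [TapeLetter.cell true]) (c := fun _ => []) fun a _ =>
      transduce_append_of_eq (transduce_toArcs_endBlock n a.1).1
        (transduce_toArcs_endBlock n a.2).2
  have := transduce_append_of_eq h1 h3
  simpa [nodeTape, arcTape, constantWord, flatMap_nil_eq_nil, flatMap_singleton_eq_replicate]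
    using this

theorem transduce_row (m : ℕ) (p : Bool) {i : ℕ} (hi : i < m) :
    transduce forwardStep (.row p false) (arcTape m p i) =
      (.row p true, arcTape m p (i + 1), unitRow m p i) := by
  obtain ⟨k, rfl⟩ := Nat.exists_eq_add_of_lt hi
  have h1 := transduce_replicate (δ := forwardStep) (q := .row p false) (a := .cell !p)
    (b := [TapeLetter.cell !p]) (c := zeroEntry) (by simp [forwardStep]) i
  have h2 := transduce_replicate (δ := forwardStep) (q := .row p true) (a := .cell p)
    (b := [TapeLetter.cell p]) (c := zeroEntry) (by simp [forwardStep]) k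
  have h4 : transduce forwardStep (.row p false) [TapeLetter.cell p] =
      (.row p true, [TapeLetter.cell !p], if p then oneEntry else negOneEntry) := by
    simp [transduce, forwardStep]
  have := transduce_append_of_eq h1 (transduce_append_of_eq h4 h2)
  simpa [arcTape, unitRow, constantWord, show i + k + 1 - i = k + 1 by omega,
    show i + k + 1 - (i + 1) = k by omega, List.replicate_succ (n := k),
    List.replicate_succ' (n := i),
    -List.replicate_append_replicate] using this

theorem transduce_ones (r : List TapeLetter) :
    transduce forwardStep .ones r = (.ones, r, constantWord oneEntry r.length) := by
  induction r with
  | nil => rfl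
  | cons a r ih => simp [transduce, forwardStep, ih, constantWord, List.replicate_succ]

theorem transduce_zeros (r : List TapeLetter) :
    transduce forwardStep .zeros r = (.zeros, r, constantWord zeroEntry r.length) := by
  induction r with
  | nil => rfl
  | cons a r ih => simp [transduce, forwardStep, ih, constantWord, List.replicate_succ]

theorem transduce_backward_zeros (r : List TapeLetter) :
    transduce backwardStep .zeros r = (.zeros, r, constantWord zeroEntry r.length) := by
  induction r with
  | nil => rfl
  | cons a r ih => simp [transduce, backwardStep, ih, constantWord, List.replicate_succ]

theorem transduce_backward_ones (r : List TapeLetter) :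
    transduce backwardStep .ones r = (.ones, [], constantWord oneEntry r.length) := by
  induction r with
  | nil => rfl
  | cons a r ih => simp [transduce, backwardStep, ih, constantWord, List.replicate_succ]

/-- The word that encodes a digraph with `n` nodes and the list `l` of arcs. -/
def inputWord (n : ℕ) (l : List (ℕ × ℕ)) : List DigraphLetter :=
  (encUnary n ++ [DigraphLetter.comma]) ++
    l.flatMap fun a => (encUnary a.1 ++ [DigraphLetter.comma]) ++
      (encUnary a.2 ++ [DigraphLetter.comma])

theorem transduce_inputWord (n : ℕ) (l : List (ℕ × ℕ)) :
    transduce readStep .nodes (inputWord n l) = (.tails, nodeTape n l 0, []) := by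
  have h1 := transduce_replicate (δ := readStep) (q := .nodes) (a := .stroke)
    (b := [TapeLetter.cell true]) (c := []) rfl n
  have h2 : transduce readStep .nodes [DigraphLetter.comma] = (.tails, [], []) := rfl
  have h3 := transduce_flatMap (l := l) (q := ReadState.tails) (δ := readStep)
    (u := fun a => (encUnary a.1 ++ [DigraphLetter.comma]) ++
      (encUnary a.2 ++ [DigraphLetter.comma]))
    (b := arcBlock 0) (c := fun _ => []) fun a _ => by
      have h4 := transduce_replicate (δ := readStep) (q := .tails) (a := .stroke)
        (b := [.stroke]) (c := []) rfl a.1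
      have h5 : transduce readStep .tails [DigraphLetter.comma] =
          (.heads, [TapeLetter.tailEnd true], []) := rfl
      have h6 := transduce_replicate (δ := readStep) (q := .heads) (a := .stroke)
        (b := [.stroke]) (c := []) rfl a.2
      have h7 : transduce readStep .heads [DigraphLetter.comma] =
          (.tails, [TapeLetter.headEnd true], []) := rfl
      have := transduce_append_of_eq (transduce_append_of_eq h4 h5)
        (transduce_append_of_eq h6 h7)
      simpa [encUnary, arcBlock, endBlock] using this
  have := transduce_append_of_eq (transduce_append_of_eq h1 h2) h3
  simpa [inputWord, encUnary, nodeTape, flatMap_nil_eq_nil] using this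

theorem length_endBlock_le (e : Bool → TapeLetter) (v t : ℕ) :
    (endBlock e v t).length ≤ t + 1 := by
  unfold endBlock
  split_ifs <;> simp

theorem length_inputWord (n : ℕ) (l : List (ℕ × ℕ)) :
    (inputWord n l).length = n + 1 + (l.map fun a => a.1 + a.2 + 2).sum := by
  simp only [inputWord, encUnary, List.length_append, List.length_replicate, List.length_singleton,
    List.length_flatMap]
  congr 3
  funext a
  ring

theorem length_nodeTape_le {n v : ℕ} (hv : v ≤ n) (l : List (ℕ × ℕ)) :
    (nodeTape n l v).length ≤ (inputWord n l).length := by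
  have : (l.map fun a => (arcBlock v a).length).sum ≤ (l.map fun a => a.1 + a.2 + 2).sum := by
    refine List.sum_le_sum fun a _ => ?_
    have h1 := length_endBlock_le .tailEnd v a.1
    have h2 := length_endBlock_le .headEnd v a.2
    simp only [arcBlock, List.length_append]
    omega
  rw [length_inputWord]
  simp only [nodeTape, List.length_append, List.length_replicate, List.length_flatMap]
  omega

theorem length_arcTape {m i : ℕ} (hi : i ≤ m) (p : Bool) : (arcTape m p i).length = m := by
  simp [arcTape, hi]

/-- The word that the machine writes for a digraph with `n` nodes and the list `l` of arcs: the
codes of `A`, `b`, `B`, `d`, `x`, `y` and the number 2. -/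
def outputWord (n : ℕ) (l : List (ℕ × ℕ)) : List LPLetter :=
  ((List.range n).flatMap fun v => incidenceRow l v ++ [LPLetter.semicolon]) ++ [LPLetter.bar] ++
  constantWord zeroEntry n ++ [LPLetter.semicolon] ++
  ((List.range l.length).flatMap fun i => unitRow l.length true i ++ [LPLetter.semicolon]) ++
  ((List.range l.length).flatMap fun i => unitRow l.length false i ++ [LPLetter.semicolon]) ++
  [LPLetter.bar] ++
  constantWord oneEntry l.length ++ constantWord zeroEntry l.length ++ [LPLetter.semicolon] ++
  constantWord zeroEntry l.length ++ [LPLetter.semicolon] ++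
  constantWord oneEntry l.length ++ [LPLetter.semicolon, LPLetter.bit false, LPLetter.bit true]

/-! ### The whole run -/

/-- The stacks with the working tape `t` to the left and the word `w` written so far. -/
def onLeft (t : List TapeLetter) (w : List LPLetter) : ∀ k, List (StackLetter k) :=
  stackContents [] t [] w.reverse []

/-- The stacks with the working tape `t` to the right and the word `w` written so far. -/
def onRight (t : List TapeLetter) (w : List LPLetter) : ∀ k, List (StackLetter k) :=
  stackContents [] [] t.reverse w.reverse []

theorem reaches_forward {q q' : ForwardState} {p : Phase} {t t' : List TapeLetter}
    {c e : List LPLetter} (h : transduce forwardStep q t = (q', t', c))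
    (he : forwardEnd q' = (p, e)) (w : List LPLetter) :
    Reaches (t.length + 1) (.forward q) (onLeft t w) p (onRight t' (w ++ c ++ e)) := by
  simpa [he, onLeft, onRight] using reaches_of_transduce_forward h [] w

theorem reaches_backward {q q' : BackwardState} {p : Phase} {t t' : List TapeLetter}
    {c e : List LPLetter} (h : transduce backwardStep q t.reverse = (q', t'.reverse, c))
    (he : backwardEnd q' = (p, e)) (w : List LPLetter) :
    Reaches (t.length + 1) (.backward q) (onRight t w) p (onLeft t' (w ++ c ++ e)) := by
  simpa [he, onLeft, onRight] using reaches_of_transduce_backward h [] w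

/-- The loop that writes the rows of a matrix: passes from left to right that write a row,
alternate with passes from right to left that restore the tape. -/
theorem reaches_rows {q : ForwardState} {q' : BackwardState} {tape : ℕ → List TapeLetter}
    {row : ℕ → List LPLetter} {n N : ℕ}
    (hf : ∀ v < n, ∀ w, Reaches ((tape v).length + 1) (.forward q) (onLeft (tape v) w)
      (.backward q') (onRight (tape (v + 1)) (w ++ row v)))
    (hb : ∀ v < n, ∀ w, Reaches ((tape v).length + 1) (.backward q') (onRight (tape v) w)
      (.forward q) (onLeft (tape v) w))
    (hN : ∀ v ≤ n, (tape v).length ≤ N) (k v : ℕ) (hv : v + (k + 1) = n) (w : List LPLetter) :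
    Reaches (2 * (N + 1) * (k + 1)) (.forward q) (onLeft (tape v) w)
      (.backward q') (onRight (tape n) (w ++ (List.range' v (k + 1)).flatMap row)) := by
  induction k generalizing v w with
  | zero =>
    subst hv
    have hl := hN v (by omega)
    exact Reaches.mono (by simpa using hf v (by omega) w) (by omega)
  | succ k ih =>
    have hl := hN v (by omega)
    have hl' := hN (v + 1) (by omega)
    refine Reaches.mono (((hf v (by omega) w).trans (hb (v + 1) (by omega) _)).trans
      (by simpa [List.range'_succ] using ih (v + 1) (by omega) (w ++ row v))) ?_
    rw [Nat.mul_succ _ (k + 1)]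
    omega

theorem reaches_restore_nodeTape {n v : ℕ} (hv : v < n) (l : List (ℕ × ℕ)) (w : List LPLetter) :
    Reaches ((nodeTape n l v).length + 1) (.backward (.nodes false)) (onRight (nodeTape n l v) w)
      (.forward .findNode) (onLeft (nodeTape n l v) w) := by
  have hmem : TapeLetter.cell true ∈ (nodeTape n l v).reverse := by
    have : n - v ≠ 0 := by omega
    simp [nodeTape, this]
  have h := transduce_backward_nodes false (nodeTape n l v).reverse
  rw [decide_eq_true hmem] at h
  simpa using reaches_backward h rfl w

theorem reaches_toArcs (n : ℕ) (l : List (ℕ × ℕ)) (w : List LPLetter) :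
    Reaches ((nodeTape n l n).length + 1) (.backward (.nodes false)) (onRight (nodeTape n l n) w)
      (.forward .toArcs) (onLeft (nodeTape n l n) (w ++ [LPLetter.bar])) := by
  have hmem : TapeLetter.cell true ∉ (nodeTape n l n).reverse := by
    have h (e : Bool → TapeLetter) (he : ∀ b, TapeLetter.cell true ≠ e b) (t : ℕ) :
        TapeLetter.cell true ∉ endBlock e n t := by
      unfold endBlock
      split_ifs <;> simp [he]
    simp [nodeTape, arcBlock, h]
  have h := transduce_backward_nodes false (nodeTape n l n).reverse
  rw [decide_eq_false hmem] at h
  simpa using reaches_backward h rfl w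

theorem reaches_restore_arcTape {m i : ℕ} (hi : i < m) (p : Bool) (w : List LPLetter) :
    Reaches ((arcTape m p i).length + 1) (.backward (.arcs p false)) (onRight (arcTape m p i) w)
      (.forward (.row p false)) (onLeft (arcTape m p i) w) := by
  have hmem : TapeLetter.cell p ∈ (arcTape m p i).reverse := by
    have : m - i ≠ 0 := by omega
    simp [arcTape, this]
  have h := transduce_backward_arcs p false (arcTape m p i).reverse
  rw [decide_eq_true hmem] at h
  have he : backwardEnd (.arcs p true) = (.forward (.row p false), []) := by cases p <;> rfl
  simpa using reaches_backward h he w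

theorem transduce_backward_arcTape_self (m : ℕ) (p : Bool) :
    transduce backwardStep (.arcs p false) (arcTape m p m).reverse =
      (.arcs p false, (arcTape m p m).reverse, []) := by
  have hmem : TapeLetter.cell p ∉ (arcTape m p m).reverse := by simp [arcTape]
  have h := transduce_backward_arcs p false (arcTape m p m).reverse
  rwa [decide_eq_false hmem] at h

theorem reaches_incidence_rows {n : ℕ} (hn : 0 < n) (l : List (ℕ × ℕ)) (w : List LPLetter) :
    Reaches (2 * ((inputWord n l).length + 1) * n)
      (.forward .findNode) (onLeft (nodeTape n l 0) w)
      (.backward (.nodes false)) (onRight (nodeTape n l n)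
        (w ++ (List.range n).flatMap fun v => incidenceRow l v ++ [LPLetter.semicolon])) := by
  obtain ⟨k, rfl⟩ := Nat.exists_eq_add_one_of_ne_zero hn.ne'
  rw [List.range_eq_range']
  refine reaches_rows (fun v hv w => ?_) (fun v hv w => reaches_restore_nodeTape hv l w)
    (fun v hv => length_nodeTape_le hv l) k 0 (zero_add _) w
  rw [← List.append_assoc]
  exact reaches_forward (transduce_nodeTape _ l hv) rfl w

theorem reaches_unit_rows {m : ℕ} (hm : 0 < m) (p : Bool) (w : List LPLetter) :
    Reaches (2 * (m + 1) * m) (.forward (.row p false)) (onLeft (arcTape m p 0) w)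
      (.backward (.arcs p false)) (onRight (arcTape m p m)
        (w ++ (List.range m).flatMap fun i => unitRow m p i ++ [LPLetter.semicolon])) := by
  obtain ⟨k, rfl⟩ := Nat.exists_eq_add_one_of_ne_zero hm.ne'
  rw [List.range_eq_range']
  refine reaches_rows (fun v hv w => ?_) (fun v hv w => reaches_restore_arcTape hv p w)
    (fun v hv => (length_arcTape hv p).le) k 0 (zero_add _) w
  rw [← List.append_assoc]
  exact reaches_forward (transduce_row _ p hv) rfl w

theorem le_length_inputWord (n : ℕ) (l : List (ℕ × ℕ)) :
    n ≤ (inputWord n l).length ∧ l.length ≤ (inputWord n l).length := by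
  have : l.length ≤ (l.map fun a => a.1 + a.2 + 2).sum := by
    induction l with
    | nil => simp
    | cons a l ih =>
      simp only [List.map_cons, List.sum_cons, List.length_cons]
      omega
  rw [length_inputWord]
  omega

/-- The vectors that follow the rows of the inequality matrix: two passes in each direction write
`d`, `x` and `y`. -/
theorem reaches_vectors {m : ℕ} {t : List TapeLetter} (ht : t.length = m) (w : List LPLetter) :
    Reaches (4 * (m + 1)) (.forward .ones) (onLeft t w) .flush (onLeft []
      (w ++ constantWord oneEntry m ++ constantWord zeroEntry m ++ [LPLetter.semicolon] ++
        constantWord zeroEntry m ++ [LPLetter.semicolon] ++ constantWord oneEntry m ++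
        [LPLetter.semicolon, LPLetter.bit false, LPLetter.bit true])) := by
  subst ht
  have r₁ := reaches_forward (transduce_ones t) rfl w
  have r₂ := r₁.trans (reaches_backward (transduce_backward_zeros t.reverse) rfl _)
  have r₃ := r₂.trans (reaches_forward (transduce_zeros t) rfl _)
  have r₄ := r₃.trans (reaches_backward (t' := []) (transduce_backward_ones t.reverse) rfl _)
  simp only [List.length_reverse, List.append_nil] at r₄
  exact r₄.mono (by omega)

/-- The run up to the last phase, in quadratic time: the number of passes is linear, and
the tape is never longer than the input. -/
theorem reaches_flush {n : ℕ} (hn : 0 < n) {l : List (ℕ × ℕ)} (hl : 0 < l.length) :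
    Reaches (11 * ((inputWord n l).length + 1) ^ 2) (.read .nodes)
      (stackContents (inputWord n l) [] [] [] []) .flush (onLeft [] (outputWord n l)) := by
  obtain ⟨hnN, hmN⟩ := le_length_inputWord n l
  have h0 := length_nodeTape_le (Nat.zero_le n) l
  have h1 := length_nodeTape_le le_rfl (n := n) l
  have r₁ : Reaches ((inputWord n l).length + 1) (.read .nodes)
      (stackContents (inputWord n l) [] [] [] []) (.backward (.nodes false))
      (onRight (nodeTape n l 0) []) := by
    simpa [onRight] using reaches_of_transduce_read (transduce_inputWord n l) [] []
  have r₂ := (r₁.trans (reaches_restore_nodeTape hn l _)).trans (reaches_incidence_rows hn l _)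
  have r₃ := (r₂.trans (reaches_toArcs n l _)).trans (reaches_forward (transduce_toArcs n l) rfl _)
  have r₄ := (r₃.trans (reaches_restore_arcTape hl true _)).trans (reaches_unit_rows hl true _)
  have r₅ := r₄.trans (reaches_backward (transduce_backward_arcTape_self _ true) rfl _)
  -- The rows of the identity matrix turn all cells, which is where its negative starts.
  rw [show arcTape l.length true l.length = arcTape l.length false 0 by simp [arcTape]] at r₅
  have r₆ := (r₅.trans (reaches_unit_rows hl false _)).trans
    (reaches_backward (transduce_backward_arcTape_self _ false) rfl _)
  have r₇ := r₆.trans (reaches_vectors (length_arcTape le_rfl false) _)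
  simp only [length_arcTape, le_refl, Nat.zero_le] at r₇
  generalize (nodeTape n l 0).length = a at *
  generalize (nodeTape n l n).length = b at *
  generalize hN : (inputWord n l).length = N at *
  generalize hm : l.length = m at *
  have ht := r₇.mono (t' := 11 * (N + 1) ^ 2) (by nlinarith)
  simpa [outputWord, hm] using ht

/-! ### The words of instances -/

/-- The list of the arcs of a digraph, as pairs of tail and head. -/
def FinDigraph.arcList (G : FinDigraph) : List (ℕ × ℕ) :=
  List.ofFn fun e => ((G.tail e : ℕ), (G.head e : ℕ))

@[simp]
theorem FinDigraph.length_arcList (G : FinDigraph) : G.arcList.length = G.m := by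
  simp [FinDigraph.arcList]

theorem flatMap_ofFn {A B : Type} {n : ℕ} (f : Fin n → A) (g : A → List B) :
    (List.ofFn f).flatMap g = (List.ofFn fun i => g (f i)).flatten := by
  rw [List.flatMap_def, List.map_ofFn]
  rfl

theorem flatMap_range {B : Type} (n : ℕ) (g : ℕ → List B) :
    (List.range n).flatMap g = (List.ofFn fun i : Fin n => g i).flatten := by
  rw [← flatMap_ofFn (fun i : Fin n => (i : ℕ)) g]
  congr 1
  refine List.ext_getElem (by simp) fun i h1 h2 => by simp

theorem encDigraph_eq (G : FinDigraph) : encDigraph G = inputWord G.n G.arcList := by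
  rw [encDigraph, inputWord, FinDigraph.arcList, flatMap_ofFn]
  simp [encNumbers]

theorem encRat_zero : encRat 0 ++ [LPLetter.comma] = zeroEntry := by
  simp [encRat, encNat, zeroEntry, Computability.encodeNat, Computability.encodeNum,
    Computability.encodePosNum]

theorem encRat_one : encRat 1 ++ [LPLetter.comma] = oneEntry := by
  simp [encRat, encNat, oneEntry, Computability.encodeNat, Computability.encodeNum,
    Computability.encodePosNum]

theorem encRat_neg_one : encRat (-1) ++ [LPLetter.comma] = negOneEntry := by
  simp [encRat, encNat, negOneEntry, Computability.encodeNat, Computability.encodeNum,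
    Computability.encodePosNum]

theorem encNat_two : encNat 2 = [LPLetter.bit false, LPLetter.bit true] := rfl

theorem flatMap_encRat_replicate (k : ℕ) :
    (List.replicate k (0 : ℚ)).flatMap (fun q => encRat q ++ [LPLetter.comma]) =
        constantWord zeroEntry k ∧
      (List.replicate k (1 : ℚ)).flatMap (fun q => encRat q ++ [LPLetter.comma]) =
        constantWord oneEntry k := by
  rw [List.flatMap_def, List.flatMap_def, List.map_replicate, List.map_replicate, encRat_zero,
    encRat_one]
  exact ⟨rfl, rfl⟩

theorem encVec_zero (k : ℕ) :
    encVec (fun _ : Fin k => (0 : ℚ)) = constantWord zeroEntry k ++ [LPLetter.semicolon] := by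
  rw [encVec, List.ofFn_const, encRatList, (flatMap_encRat_replicate k).1]

theorem encVec_one (k : ℕ) :
    encVec (fun _ : Fin k => (1 : ℚ)) = constantWord oneEntry k ++ [LPLetter.semicolon] := by
  rw [encVec, List.ofFn_const, encRatList, (flatMap_encRat_replicate k).2]

theorem encVec_append_one_zero (k : ℕ) :
    encVec (Fin.append (fun _ : Fin k => (1 : ℚ)) (fun _ : Fin k => 0)) =
      constantWord oneEntry k ++ constantWord zeroEntry k ++ [LPLetter.semicolon] := by
  rw [encVec, List.ofFn_fin_append, List.ofFn_const, List.ofFn_const, encRatList,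
    List.flatMap_append, (flatMap_encRat_replicate k).1, (flatMap_encRat_replicate k).2]

theorem ofFn_ite_eq {m : ℕ} (i : Fin m) (q : ℚ) :
    (List.ofFn fun j => if i = j then q else 0) =
      List.replicate i 0 ++ q :: List.replicate (m - i - 1) 0 := by
  refine List.ext_getElem (by simp; omega) fun j h1 h2 => ?_
  simp only [List.length_ofFn] at h1
  rw [List.getElem_ofFn, List.getElem_append]
  rcases lt_trichotomy j i.1 with h | h | h
  · simp [h, Fin.ext_iff, h.ne']
  · simp [h]
  · obtain ⟨k, hk⟩ := Nat.exists_eq_add_of_lt h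
    simp [Fin.ext_iff, h.ne, not_lt.2 h.le, List.getElem_cons, show j - i.1 ≠ 0 by omega]

theorem encRatList_unit {m : ℕ} (i : Fin m) (p : Bool) :
    encRatList (List.ofFn fun j => if i = j then (if p then 1 else -1) else 0) =
      unitRow m p i ++ [LPLetter.semicolon] := by
  rw [ofFn_ite_eq, encRatList, List.flatMap_append, List.flatMap_cons,
    (flatMap_encRat_replicate _).1, (flatMap_encRat_replicate _).1]
  cases p
  · simp [unitRow, ← encRat_neg_one]
  · simp [unitRow, ← encRat_one]

theorem encRatList_incidence (G : FinDigraph) (v : Fin G.n) :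
    encRatList (List.ofFn (G.incidence v)) =
      incidenceRow G.arcList v ++ [LPLetter.semicolon] := by
  rw [encRatList, incidenceRow, FinDigraph.arcList, flatMap_ofFn, flatMap_ofFn]
  congr 3
  funext e
  simp only [FinDigraph.incidence, Matrix.of_apply, Fin.val_inj]
  by_cases h1 : G.head e = v <;> by_cases h2 : G.tail e = v <;>
    simp only [h1, h2, if_true, if_false, decide_true, decide_false, sub_self, sub_zero, zero_sub]
  exacts [encRat_zero, encRat_one, encRat_neg_one, encRat_zero]

theorem encMat_incidence (G : FinDigraph) :
    encMat G.incidence = ((List.range G.n).flatMap fun v =>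
      incidenceRow G.arcList v ++ [LPLetter.semicolon]) ++ [LPLetter.bar] := by
  rw [encMat, encRows, flatMap_range, flatMap_ofFn]
  simp only [encRatList_incidence]

theorem encMat_bounds (G : FinDigraph) :
    encMat G.circulationPolytope.B =
      ((List.range G.m).flatMap fun i => unitRow G.m true i ++ [LPLetter.semicolon]) ++
      ((List.range G.m).flatMap fun i => unitRow G.m false i ++ [LPLetter.semicolon]) ++
      [LPLetter.bar] := by
  have h : (List.ofFn fun i => List.ofFn (G.circulationPolytope.B i)) =
      (List.ofFn fun i : Fin G.m => List.ofFn fun j : Fin G.m =>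
        if i = j then (if true then (1 : ℚ) else -1) else 0) ++
      (List.ofFn fun i : Fin G.m => List.ofFn fun j : Fin G.m =>
        if i = j then (if false then (1 : ℚ) else -1) else 0) := by
    refine List.ofFn_add.trans ?_
    congr 2
    · funext i
      congr 1
      funext j
      simp [FinDigraph.circulationPolytope, Matrix.one_apply]
    · funext i
      congr 1
      funext j
      simp only [FinDigraph.circulationPolytope, Matrix.of_apply, Fin.append_right]
      by_cases hij : i = j <;> simp [hij]
  rw [encMat, h, encRows, List.flatMap_append, flatMap_ofFn, flatMap_ofFn, flatMap_range,
    flatMap_range]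
  have ht := fun i : Fin G.m => encRatList_unit i true
  have hf := fun i : Fin G.m => encRatList_unit i false
  simp only [if_true, Bool.false_eq_true, if_false] at ht hf ⊢
  simp only [ht, hf]

theorem encCircDist_zeroToFullFlow (G : TwoRegularEulerianDigraph) :
    encCircDist (zeroToFullFlow G) = outputWord G.1.n G.1.arcList := by
  have h : encCircDist (zeroToFullFlow G) = encMat G.1.incidence ++
      (encVec (fun _ : Fin G.1.n => (0 : ℚ)) ++ (encMat G.1.circulationPolytope.B ++
      (encVec (Fin.append (fun _ : Fin G.1.m => (1 : ℚ)) (fun _ : Fin G.1.m => 0)) ++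
      (encVec (fun _ : Fin G.1.m => (0 : ℚ)) ++ (encVec (fun _ : Fin G.1.m => (1 : ℚ)) ++
      encNat 2))))) := rfl
  rw [h, encMat_incidence, encMat_bounds, encVec_zero, encVec_append_one_zero, encVec_zero,
    encVec_one, encNat_two]
  simp [outputWord]

/-! ### The time bound -/

theorem length_constantWord (c : List LPLetter) (k : ℕ) :
    (constantWord c k).length = k * c.length := by
  simp [constantWord]

theorem length_flatMap_le {A B : Type} {l : List A} {f : A → List B} {k : ℕ}
    (h : ∀ a ∈ l, (f a).length ≤ k) : (l.flatMap f).length ≤ l.length * k := by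
  rw [List.length_flatMap]
  simpa using List.sum_le_card_nsmul (l.map fun a => (f a).length) k (by simpa using h)

theorem length_outputWord_le (n : ℕ) (l : List (ℕ × ℕ)) :
    (outputWord n l).length + 1 ≤ 20 * ((inputWord n l).length + 1) ^ 2 := by
  obtain ⟨hn, hm⟩ := le_length_inputWord n l
  have h1 : ((List.range n).flatMap fun v =>
      incidenceRow l v ++ [LPLetter.semicolon]).length ≤ n * (l.length * 5 + 1) := by
    refine (length_flatMap_le (k := l.length * 5 + 1) fun v _ => ?_).trans (by simp)
    · have := length_flatMap_le (l := l) (k := 5)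
        (f := fun a => incidenceEntry (decide (a.1 = v)) (decide (a.2 = v)))
        fun a _ => length_incidenceEntry _ _
      simpa [incidenceRow] using this
  have h2 (p : Bool) : ((List.range l.length).flatMap fun i =>
      unitRow l.length p i ++ [LPLetter.semicolon]).length ≤ l.length * (l.length * 5 + 1) := by
    refine (length_flatMap_le (k := l.length * 5 + 1) fun i hi => ?_).trans (by simp)
    · have hi' := List.mem_range.1 hi
      have h5 : (if p then oneEntry else negOneEntry).length ≤ 5 := by cases p <;> decide
      simp only [unitRow, List.length_append, length_constantWord, List.length_singleton,
        show zeroEntry.length = 3 from rfl]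
      omega
  have h3 := h2 true
  have h4 := h2 false
  simp only [outputWord, List.length_append, length_constantWord, List.length_cons,
    List.length_nil, show zeroEntry.length = 3 from rfl, show oneEntry.length = 4 from rfl]
  generalize (inputWord n l).length = N at *
  have e1 : n * (l.length * 5 + 1) ≤ N * (N * 5 + 1) := by gcongr
  have e2 : l.length * (l.length * 5 + 1) ≤ N * (N * 5 + 1) := by gcongr
  nlinarith

/-! ### The reduction -/

/-- The machine outputs the instance of the circuit distance problem in quadratic time. -/
theorem machine_outputs (G : TwoRegularEulerianDigraph) :
    ∃ k ≤ 31 * ((encDigraph G.1).length + 1) ^ 2,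
      (fun c => Option.bind c (Turing.TM2.step program))^[k]
        (some ⟨some (.read .nodes), (none, none, none),
          stackContents (encDigraph G.1) [] [] [] []⟩) =
        some ⟨none, (none, none, none),
          stackContents [] [] [] [] (encCircDist (zeroToFullFlow G))⟩ := by
  obtain ⟨c, hc, -, -⟩ := G.2.1
  obtain ⟨e, -⟩ := List.exists_mem_of_ne_nil c hc.1
  obtain ⟨v, k, hk, h⟩ := reaches_flush (n := G.1.n) (l := G.1.arcList) (G.1.tail e).pos
    (by simpa using e.pos) (none, none, none)
  have hflush := iterate_step_flush (outputWord G.1.n G.1.arcList).reverse [] v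
  have hlen := length_outputWord_le G.1.n G.1.arcList
  refine ⟨(outputWord G.1.n G.1.arcList).reverse.length + 1 + k, ?_, ?_⟩
  · rw [encDigraph_eq, List.length_reverse]
    omega
  · rw [Function.iterate_add_apply, encDigraph_eq, encCircDist_zeroToFullFlow, h]
    simpa [onLeft] using hflush

theorem initList_machine (w : List DigraphLetter) :
    Turing.initList machine w =
      (⟨some (.read .nodes), (none, none, none), stackContents w [] [] [] []⟩ :
        Turing.TM2.Cfg _ _ _) := by
  unfold Turing.initList
  congr 1
  funext k
  cases k <;> rfl

theorem haltList_machine (w : List LPLetter) :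
    Turing.haltList machine w =
      (⟨none, (none, none, none), stackContents [] [] [] [] w⟩ : Turing.TM2.Cfg _ _ _) := by
  unfold Turing.haltList
  congr 1
  funext k
  cases k <;> rfl

theorem polyTime_zeroToFullFlow :
    Nonempty (Turing.TM2ComputableInPolyTime twoHamiltonianDicycles.encoding.encode
      circDist.encoding.encode zeroToFullFlow) := by
  choose k hk h using machine_outputs
  refine ⟨{
    tm := machine
    inputAlphabet := Equiv.refl DigraphLetter
    outputAlphabet := Equiv.refl LPLetter
    time := Polynomial.C 31 * (Polynomial.X + 1) ^ 2
    outputsFun := fun G => ⟨⟨k G, ?_⟩, ?_⟩ }⟩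
  · have hin := fun w : List DigraphLetter =>
      (congrArg (Turing.initList machine) (List.map_id w)).trans (initList_machine w)
    have hout := fun w : List LPLetter =>
      (congrArg (Turing.haltList machine) (List.map_id w)).trans (haltList_machine w)
    exact (congrArg _ (congrArg some (hin _))).trans
      ((h G).trans (congrArg some (hout _).symm))
  · simp only [Polynomial.eval_mul, Polynomial.eval_C, Polynomial.eval_pow, Polynomial.eval_add,
      Polynomial.eval_X, Polynomial.eval_one]
    exact hk G

end CircuitDistance

/-- Circ-Dist is at least as hard as deciding whether an Eulerian digraph with in-degree and
out-degree 2 decomposes into two Hamiltonian dicycles: the map that sends such a digraph to its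
0/1-circulation polytope, with the zero flow, the full flow and `k = 2`, is a polynomial-time
many-one reduction. -/
theorem corollary2 :
    CircuitDistance.IsPolyTimeReduction CircuitDistance.twoHamiltonianDicycles
      CircuitDistance.circDist CircuitDistance.zeroToFullFlow ∧
    CircuitDistance.PolyTimeReducible CircuitDistance.twoHamiltonianDicycles
      CircuitDistance.circDist := by
  have h : CircuitDistance.IsPolyTimeReduction CircuitDistance.twoHamiltonianDicycles
      CircuitDistance.circDist CircuitDistance.zeroToFullFlow :=
    ⟨CircuitDistance.polyTime_zeroToFullFlow, CircuitDistance.decomposes_iff_yes⟩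
  exact ⟨h, _, h⟩
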